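/- Let $\mathcal A,\mathcal E$ be finite sets, let $P=P_{A,E}$ be a probability distribution on $\mathcal A\times\mathcal E$, let $P^n$ be its $n$-fold i.i.d. extension on $\mathcal A^n\times\mathcal E^n$, and let $\varepsilon>0$ and $R\in\mathbb R$ be fixed. All logarithms are natural, $\|\cdot\|_1$ is the $\ell_1$ norm, and $\eta(x,y):=-x\log x+xy$ with $\eta(0,y)=0$. For a sub-distribution $P'$ on $\mathcal A\times\mathcal E$ (nonnegative, of total mass at most $1$) with marginal $P'_E$, and a probability distribution $Q$ on $\mathcal E$, put $$H_{\min}(A|E|P'\|Q):=-\log\max_{a,e}\frac{P'(a,e)}{Q(e)},\qquad H_{1+s}(A|E|P\|Q):=-\frac1s\log\sum_{a,e}P(a,e)^{1+s}Q(e)^{-s}\quad(s>0),$$ with values in $[-\infty,+\infty]$. Here a quotient, or a term of the sum, counts as $+\infty$ if its $Q(e)$ is $0$ and its numerator, respectively $P(a,e)$, is positive; it counts as $0$ if the numerator, respectively $P(a,e)$, is $0$. Also $\log 0=-\infty$ and $e^{-\infty}=0$. For $s>0$ put $$H^{\downarrow}_{1+s}(A|E|P):=H_{1+s}(A|E|P\|P_E),\qquad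 H^{\uparrow}_{1+s}(A|E|P):=\max_{Q}H_{1+s}(A|E|P\|Q),$$ and let $H^{\downarrow}_1=H^{\uparrow}_1:=H(A|E|P)$ be the conditional Shannon entropy. For real $M>0$ define the min-entropy smoothing bounds $$\Delta_{d,\min}(M,\varepsilon|P):=\min_{Q}\min_{P'}\Big(2\|P-P'\|_1+\sqrt{\varepsilon}\,M^{1/2}e^{-\frac12H_{\min}(A|E|P'\|Q)}\Big),$$ $$\Delta_{I,\min}(M,\varepsilon|P):=\min_{P':\,P'_E\le P_E}\Big(\eta(\|P-P'\|_1,\log M)+\varepsilon M e^{-H_{\min}(A|E|P'\|P_E)}\Big),$$ where $Q$ ranges over the probability distributions on $\mathcal E$ and $P'$ over the sub-distributions on $\mathcal A\times\mathcal E$. For $P^n$ the same definitions are used with $\mathcal A^n,\mathcal E^n$ in place of $\mathcal A,\mathcal E$. Theorem. For every $R\in\mathbb R$, $$\lim_{n\to\infty}\frac{-1}{n}\log\Delta_{d,\min}(e^{nR},\varepsilon|P^n)=\tilde e_d(P|R):=\sup_{s\ge0}\frac{s\,\big(H^{\uparrow}_{1+s}(A|E|P)-R\big)}{1+2s},$$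 and for every $R>0$ (then $\Delta_{I,\min}(e^{nR},\varepsilon|P^n)>0$ for all large $n$), $$\lim_{n\to\infty}\frac{-1}{n}\log\Delta_{I,\min}(e^{nR},\varepsilon|P^n)=\tilde e_I(P|R):=\sup_{s\ge0}\frac{s\,\big(H^{\downarrow}_{1+s}(A|E|P)-R\big)}{1+s}.$$ -/

import Mathlib

open Filter Topology

namespace MinEntropySmoothing

noncomputable section

/-- `p` is a (normalized) probability distribution on the finite set `X`. -/
def IsDist {X : Type*} [Fintype X] (p : X → ℝ) : Prop :=
  (∀ x, 0 ≤ p x) ∧ ∑ x, p x = 1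

/-- `p` is a sub-distribution on the finite set `X`. -/
def IsSubDist {X : Type*} [Fintype X] (p : X → ℝ) : Prop :=
  (∀ x, 0 ≤ p x) ∧ ∑ x, p x ≤ 1

/-- The `ℓ₁` distance. -/
def l1Dist {X : Type*} [Fintype X] (p q : X → ℝ) : ℝ :=
  ∑ x, |p x - q x|

/-- The marginal on `E` of a joint (sub-)distribution on `A × E`. -/
def margE {A E : Type*} [Fintype A] (P : A × E → ℝ) (e : E) : ℝ :=
  ∑ a, P (a, e)

/-- The `n`-fold i.i.d. extension, viewed as a joint distribution on `Aⁿ × Eⁿ`. -/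
def iid {A E : Type*} (P : A × E → ℝ) (n : ℕ) : (Fin n → A) × (Fin n → E) → ℝ :=
  fun x => ∏ i, P (x.1 i, x.2 i)

/-- Shannon entropy (natural logarithm, `0 log 0 = 0`). -/
def shannonEntropy {X : Type*} [Fintype X] (p : X → ℝ) : ℝ :=
  -∑ x, p x * Real.log (p x)

/-- Conditional entropy `H(A|E|P) = H(A,E|P) - H(E|P_E)` of a joint distribution. -/
def condEntropy {A E : Type*} [Fintype A] [Fintype E] (P : A × E → ℝ) : ℝ :=
  shannonEntropy P - shannonEntropy (margE P)

/-- Conditional Rényi entropy of order `1 + s` relative to `Q`, for `s > 0`: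
`H_{1+s}(A|E|P‖Q) = -(1/s) log ∑_{a,e} P(a,e)^{1+s} Q(e)^{-s}`. The sum is taken in `[0, ∞]`,
so that a term with `Q e = 0 < P (a, e)` is infinite and a term with `P (a, e) = 0` vanishes. -/
def renyiRel {A E : Type*} [Fintype A] [Fintype E] (s : ℝ) (P : A × E → ℝ) (Q : E → ℝ) : EReal :=
  ((-(1 / s) : ℝ) : EReal) *
    ENNReal.log (∑ x : A × E, ENNReal.ofReal (P x) ^ (1 + s) * ENNReal.ofReal (Q x.2) ^ (-s))

/-- `H^↓_{1+s}(A|E|P)`: the choice `Q = P_E`, and the conditional entropy for `s = 0`. -/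
def renyiDown {A E : Type*} [Fintype A] [Fintype E] (s : ℝ) (P : A × E → ℝ) : EReal :=
  if s = 0 then (condEntropy P : EReal) else renyiRel s P (margE P)

/-- `H^↑_{1+s}(A|E|P)`: the optimum over all distributions `Q` on `E`, and the conditional
entropy for `s = 0`. -/
def renyiUp {A E : Type*} [Fintype A] [Fintype E] (s : ℝ) (P : A × E → ℝ) : EReal :=
  if s = 0 then (condEntropy P : EReal)
  else ⨆ (Q : E → ℝ) (_ : IsDist Q), renyiRel s P Q

/-- Conditional min-entropy relative to `Q`: `H_min(A|E|P‖Q) = -log max_{a,e} P(a,e)/Q(e)`.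
The quotient is taken in `[0, ∞]`: it is `∞` if `Q e = 0 < P (a, e)`, and `0 / 0 = 0`.
In particular `H_min = +∞` for `P = 0`. -/
def minEntropy {A E : Type*} (P : A × E → ℝ) (Q : E → ℝ) : EReal :=
  -ENNReal.log (⨆ x : A × E, ENNReal.ofReal (P x) / ENNReal.ofReal (Q x.2))

/-- `η(x, y) = -x log x + x y`. -/
def eta (x y : ℝ) : ℝ := -(x * Real.log x) + x * y

/-- The smoothing bound `Δ_{d,min}(M, ε|P)`: the minimum, over distributions `Q` on `E` and
sub-distributions `P'` on `A × E`, of `2 ‖P - P'‖₁ + √ε √M exp(-H_min(A|E|P'‖Q)/2)`. -/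
def deltaDMin {A E : Type*} [Fintype A] [Fintype E] (M ε : ℝ) (P : A × E → ℝ) : EReal :=
  ⨅ (Q : E → ℝ) (_ : IsDist Q) (P' : A × E → ℝ) (_ : IsSubDist P'),
    ((2 * l1Dist P P' : ℝ) : EReal) +
      ((√ε * √M : ℝ) : EReal) *
        (EReal.exp (((-(1 / 2) : ℝ) : EReal) * minEntropy P' Q) : EReal)

/-- The smoothing bound `Δ_{I,min}(M, ε|P)`: the minimum, over sub-distributions `P'` on `A × E`
with `P'_E ≤ P_E`, of `η(‖P - P'‖₁, log M) + ε M exp(-H_min(A|E|P'‖P_E))`. -/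
def deltaIMin {A E : Type*} [Fintype A] [Fintype E] (M ε : ℝ) (P : A × E → ℝ) : EReal :=
  ⨅ (P' : A × E → ℝ) (_ : IsSubDist P') (_ : ∀ e, margE P' e ≤ margE P e),
    ((eta (l1Dist P P') (Real.log M) : ℝ) : EReal) +
      ((ε * M : ℝ) : EReal) * (EReal.exp (-minEntropy P' (margE P)) : EReal)

/-- `-(1/n) log x` for `x ∈ [0, ∞]`, with `log 0 = -∞`. -/
def expRate (n : ℕ) (x : EReal) : EReal :=
  ((-(1 / (n : ℝ)) : ℝ) : EReal) * ENNReal.log x.toENNReal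

/-- `ẽ_d(P|R) = sup_{s ≥ 0} s (H^↑_{1+s}(A|E|P) - R) / (1 + 2s)`. -/
def expD {A E : Type*} [Fintype A] [Fintype E] (P : A × E → ℝ) (R : ℝ) : EReal :=
  ⨆ (s : ℝ) (_ : 0 ≤ s), ((s / (1 + 2 * s) : ℝ) : EReal) * (renyiUp s P - (R : EReal))

/-- `ẽ_I(P|R) = sup_{s ≥ 0} s (H^↓_{1+s}(A|E|P) - R) / (1 + s)`. -/
def expI {A E : Type*} [Fintype A] [Fintype E] (P : A × E → ℝ) (R : ℝ) : EReal :=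
  ⨆ (s : ℝ) (_ : 0 ≤ s), ((s / (1 + s) : ℝ) : EReal) * (renyiDown s P - (R : EReal))

end

end MinEntropySmoothing

/-! Both exponents come from the trade-off between the mass removed from `P` and the largest ratio
`P'/Q` that remains.

For the upper bounds on the smoothing quantities, truncate the i.i.d. law to the set where it is at
most `t` times the product of `Q`. A Markov-type inequality of order `s` controls the lost mass, and
`t = exp (-(n * τ))` is chosen so that both terms decay at the same rate (`deltaDMin_iid_le`,
`deltaIMin_iid_le`).

For the lower bounds, fix `W` absolutely continuous with respect to `P`. The `W`-typical sequences
carry `P`-mass about `exp (-n D(W‖P))`. A small `t` forces `P'` to miss a fixed fraction of this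
mass; a large `t` makes the second term large. Hence the exponent is at most the maximum of two
convex functions of `W` (`eventually_le_deltaDMin`, `eventually_le_deltaIMin`).

It remains to minimise that maximum over `W`. A two-function minimax (`exists_weight_forall_le`)
replaces it by a convex combination, and at an explicit tilted `W` the combination equals one member
of the supremum over `s` (`exists_max_lt_of_expD_lt`, `exists_max_lt_of_expI_lt`). -/

namespace MinEntropySmoothing

/-! ### Real-valued form of the minimisations: a number `t` with `P' ≤ t Q` replaces the
min-entropy. -/

section Bridge

variable {A E : Type*}

lemma iSup_ratio_le {P' : A × E → ℝ} {Q : E → ℝ} {t : ℝ} (ht : 0 ≤ t)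
    (h : ∀ x : A × E, P' x ≤ t * Q x.2) :
    (⨆ x : A × E, ENNReal.ofReal (P' x) / ENNReal.ofReal (Q x.2)) ≤ ENNReal.ofReal t := by
  refine iSup_le fun x => ENNReal.div_le_of_le_mul ?_
  rw [← ENNReal.ofReal_mul ht]
  exact ENNReal.ofReal_le_ofReal (h x)

lemma le_toReal_iSup_ratio_mul {P' : A × E → ℝ} {Q : E → ℝ} (hQ : ∀ e, 0 ≤ Q e)
    (hS : (⨆ x : A × E, ENNReal.ofReal (P' x) / ENNReal.ofReal (Q x.2)) ≠ ⊤) (x : A × E) :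
    P' x ≤ (⨆ x : A × E, ENNReal.ofReal (P' x) / ENNReal.ofReal (Q x.2)).toReal * Q x.2 := by
  set S := ⨆ x : A × E, ENNReal.ofReal (P' x) / ENNReal.ofReal (Q x.2) with hSdef
  have h1 : ENNReal.ofReal (P' x) / ENNReal.ofReal (Q x.2) ≤ S :=
    le_iSup (fun x : A × E => ENNReal.ofReal (P' x) / ENNReal.ofReal (Q x.2)) x
  rw [ENNReal.div_le_iff_le_mul (Or.inr hS) (Or.inl ENNReal.ofReal_ne_top)] at h1
  have h2 := (ENNReal.ofReal_le_iff_le_toReal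
    (ENNReal.mul_ne_top hS ENNReal.ofReal_ne_top)).1 h1
  rwa [ENNReal.toReal_mul, ENNReal.toReal_ofReal (hQ _)] at h2

lemma exp_neg_minEntropy (P' : A × E → ℝ) (Q : E → ℝ) :
    EReal.exp (-minEntropy P' Q) =
      ⨆ x : A × E, ENNReal.ofReal (P' x) / ENNReal.ofReal (Q x.2) := by
  rw [minEntropy, neg_neg, ENNReal.exp_log]

lemma exp_neg_half_minEntropy (P' : A × E → ℝ) (Q : E → ℝ) :
    EReal.exp (((-(1 / 2) : ℝ) : EReal) * minEntropy P' Q) =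
      (⨆ x : A × E, ENNReal.ofReal (P' x) / ENNReal.ofReal (Q x.2)) ^ (1 / 2 : ℝ) := by
  rw [minEntropy, EReal.coe_neg, neg_mul_neg, ← ENNReal.rpow_eq_exp_mul_log]

lemma ofReal_rpow_half {t : ℝ} (ht : 0 ≤ t) :
    ENNReal.ofReal t ^ (1 / 2 : ℝ) = ENNReal.ofReal √t := by
  rw [ENNReal.ofReal_rpow_of_nonneg ht (by norm_num), Real.sqrt_eq_rpow]

variable [Fintype A] [Fintype E]

lemma deltaDMin_le {M ε t : ℝ} {P P' : A × E → ℝ} {Q : E → ℝ} (hQ : IsDist Q)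
    (hP' : IsSubDist P') (ht : 0 ≤ t) (h : ∀ x : A × E, P' x ≤ t * Q x.2) :
    deltaDMin M ε P ≤ ((2 * l1Dist P P' + √ε * √M * √t : ℝ) : EReal) := by
  refine (iInf₂_le_of_le Q hQ (iInf₂_le P' hP')).trans ?_
  rw [exp_neg_half_minEntropy, EReal.coe_add, EReal.coe_mul (√ε * √M)]
  gcongr
  rw [← max_eq_left (Real.sqrt_nonneg t), ← EReal.coe_ennreal_ofReal,
    EReal.coe_ennreal_le_coe_ennreal_iff, ← ofReal_rpow_half ht]
  exact ENNReal.rpow_le_rpow (iSup_ratio_le ht h) (by norm_num)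

lemma le_deltaDMin {M ε b : ℝ} {P : A × E → ℝ} (hM : 0 < M) (hε : 0 < ε)
    (h : ∀ Q : E → ℝ, IsDist Q → ∀ P' : A × E → ℝ, IsSubDist P' → ∀ t : ℝ, 0 ≤ t →
      (∀ x : A × E, P' x ≤ t * Q x.2) → b ≤ 2 * l1Dist P P' + √ε * √M * √t) :
    (b : EReal) ≤ deltaDMin M ε P := by
  refine le_iInf₂ fun Q hQ => le_iInf₂ fun P' hP' => ?_
  rw [exp_neg_half_minEntropy]
  set S := ⨆ x : A × E, ENNReal.ofReal (P' x) / ENNReal.ofReal (Q x.2) with hSdef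
  have hc : 0 < √ε * √M := by positivity
  by_cases hS : S = ⊤
  · rw [hS, ENNReal.top_rpow_of_pos (by norm_num), EReal.coe_ennreal_top,
      EReal.coe_mul_top_of_pos hc, EReal.coe_add_top]
    exact le_top
  · have h1 := h Q hQ P' hP' S.toReal ENNReal.toReal_nonneg
      (le_toReal_iSup_ratio_mul hQ.1 hS)
    rw [← ENNReal.ofReal_toReal hS, ofReal_rpow_half ENNReal.toReal_nonneg,
      EReal.coe_ennreal_ofReal, max_eq_left (Real.sqrt_nonneg _), ← EReal.coe_mul,
      ← EReal.coe_add]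
    exact EReal.coe_le_coe_iff.2 h1

lemma deltaIMin_le {M ε t : ℝ} {P P' : A × E → ℝ} (hM : 0 ≤ M) (hε : 0 ≤ ε)
    (hP' : IsSubDist P') (hE : ∀ e, margE P' e ≤ margE P e) (ht : 0 ≤ t)
    (h : ∀ x : A × E, P' x ≤ t * margE P x.2) :
    deltaIMin M ε P ≤ ((eta (l1Dist P P') (Real.log M) + ε * M * t : ℝ) : EReal) := by
  refine (iInf₂_le_of_le P' hP' (iInf_le _ hE)).trans ?_
  rw [exp_neg_minEntropy, EReal.coe_add, EReal.coe_mul (ε * M)]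
  gcongr
  rw [← max_eq_left ht, ← EReal.coe_ennreal_ofReal, EReal.coe_ennreal_le_coe_ennreal_iff]
  exact iSup_ratio_le ht h

lemma le_deltaIMin {M ε b : ℝ} {P : A × E → ℝ} (hM : 0 < M) (hε : 0 < ε)
    (hP : ∀ e, 0 ≤ margE P e)
    (h : ∀ P' : A × E → ℝ, IsSubDist P' → ∀ t : ℝ, 0 ≤ t →
      (∀ x : A × E, P' x ≤ t * margE P x.2) →
        b ≤ eta (l1Dist P P') (Real.log M) + ε * M * t) :
    (b : EReal) ≤ deltaIMin M ε P := by
  refine le_iInf₂ fun P' hP' => le_iInf fun _ => ?_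
  rw [exp_neg_minEntropy]
  set S := ⨆ x : A × E, ENNReal.ofReal (P' x) / ENNReal.ofReal (margE P x.2) with hSdef
  have hc : 0 < ε * M := by positivity
  by_cases hS : S = ⊤
  · rw [hS, EReal.coe_ennreal_top, EReal.coe_mul_top_of_pos hc, EReal.coe_add_top]
    exact le_top
  · have h1 := h P' hP' S.toReal ENNReal.toReal_nonneg (le_toReal_iSup_ratio_mul hP hS)
    rw [← ENNReal.ofReal_toReal hS,
      EReal.coe_ennreal_ofReal, max_eq_left ENNReal.toReal_nonneg, ← EReal.coe_mul,
      ← EReal.coe_add]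
    exact EReal.coe_le_coe_iff.2 h1

end Bridge

/-! ### Exponential rates of sequences. -/

section Rate

lemma expRate_coe_exp {n : ℕ} {K c : ℝ} (hK : 0 < K) (hn : 0 < n) :
    expRate n ((K * Real.exp (-(n * c)) : ℝ) : EReal) =
      ((c - Real.log K / n : ℝ) : EReal) := by
  have hn' : (0 : ℝ) < n := by exact_mod_cast hn
  have hpos : 0 < K * Real.exp (-(n * c)) := by positivity
  rw [expRate, EReal.real_coe_toENNReal, ENNReal.log_ofReal_of_pos hpos, ← EReal.coe_mul,
    Real.log_mul hK.ne' (Real.exp_pos _).ne', Real.log_exp]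
  congr 1
  field_simp
  ring

lemma expRate_anti (n : ℕ) : Antitone (expRate n) := by
  intro x y hxy
  have h := ENNReal.log_monotone (EReal.toENNReal_le_toENNReal hxy)
  simp only [expRate, EReal.coe_neg, neg_mul]
  refine EReal.neg_le_neg_iff.2 ?_
  exact mul_le_mul_of_nonneg_left h (EReal.coe_nonneg.2 (by positivity))

lemma tendsto_sub_const_div_nat (c k : ℝ) :
    Tendsto (fun n : ℕ => ((c - k / n : ℝ) : EReal)) atTop (𝓝 (c : EReal)) := by
  refine (continuous_coe_real_ereal.tendsto c).comp ?_
  simpa using tendsto_const_nhds.sub (tendsto_const_div_atTop_nhds_zero_nat k)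

/-- The prefactor `K` shifts the rate only by `log K / n`, which vanishes. -/
lemma eventually_lt_expRate {u : ℕ → EReal} {K c : ℝ} {a : EReal} (hK : 0 < K)
    (hu : ∀ᶠ n : ℕ in atTop, u n ≤ ((K * Real.exp (-(n * c)) : ℝ) : EReal)) (ha : a < c) :
    ∀ᶠ n : ℕ in atTop, a < expRate n (u n) := by
  filter_upwards [hu, eventually_gt_atTop 0,
    (tendsto_sub_const_div_nat c (Real.log K)).eventually (eventually_gt_nhds ha)]
    with n h1 hn h2
  refine h2.trans_le ?_
  rw [← expRate_coe_exp hK hn]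
  exact expRate_anti n h1

lemma eventually_expRate_lt {u : ℕ → EReal} {K c : ℝ} {a : EReal} (hK : 0 < K)
    (hu : ∀ᶠ n : ℕ in atTop, ((K * Real.exp (-(n * c)) : ℝ) : EReal) ≤ u n) (ha : c < a) :
    ∀ᶠ n : ℕ in atTop, expRate n (u n) < a := by
  filter_upwards [hu, eventually_gt_atTop 0,
    (tendsto_sub_const_div_nat c (Real.log K)).eventually (eventually_lt_nhds ha)]
    with n h1 hn h2
  refine lt_of_le_of_lt ?_ h2
  rw [← expRate_coe_exp hK hn]
  exact expRate_anti n h1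

end Rate

/-! ### Products and marginals of i.i.d. extensions. -/

section Product

variable {A E : Type*}

lemma iid_nonneg {F : A × E → ℝ} (hF : ∀ x, 0 ≤ F x) (n : ℕ) (x) : 0 ≤ iid F n x :=
  Finset.prod_nonneg fun _ _ => hF _

/-- A bound on an empirical sum of log-ratios becomes a bound between product densities; this is how
typicality is used. -/
lemma prod_mul_exp_le {F G V : A × E → ℝ} {n : ℕ} {ν : ℝ} {x : (Fin n → A) × (Fin n → E)}
    (hG : ∀ y, 0 ≤ G y) (h : ∀ i, F (x.1 i, x.2 i) = G (x.1 i, x.2 i) *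
      Real.exp (-V (x.1 i, x.2 i))) (hV : ∑ i, V (x.1 i, x.2 i) ≤ n * ν) :
    (∏ i, G (x.1 i, x.2 i)) * Real.exp (-(n * ν)) ≤ iid F n x := by
  have : iid F n x = (∏ i, G (x.1 i, x.2 i)) * Real.exp (-∑ i, V (x.1 i, x.2 i)) := by
    rw [iid, Finset.prod_congr rfl fun i _ => h i, Finset.prod_mul_distrib, ← Real.exp_sum,
      Finset.sum_neg_distrib]
  rw [this]
  exact mul_le_mul_of_nonneg_left (Real.exp_le_exp.2 (neg_le_neg hV))
    (Finset.prod_nonneg fun _ _ => hG _)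

variable [Fintype A]

lemma margE_iid (F : A × E → ℝ) (n : ℕ) (e : Fin n → E) :
    margE (iid F n) e = ∏ i, margE F (e i) := by
  classical
  simp only [margE, iid]
  rw [Finset.prod_univ_sum, Fintype.piFinset_univ]

lemma margE_nonneg {F : A × E → ℝ} (hF : ∀ x, 0 ≤ F x) (e : E) : 0 ≤ margE F e :=
  Finset.sum_nonneg fun _ _ => hF _

lemma le_margE {F : A × E → ℝ} (hF : ∀ x, 0 ≤ F x) (x : A × E) : F x ≤ margE F x.2 :=
  Finset.single_le_sum (f := fun a => F (a, x.2)) (fun _ _ => hF _) (Finset.mem_univ x.1)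

variable [Fintype E]

lemma sum_iid (F : A × E → ℝ) (n : ℕ) : ∑ x, iid F n x = (∑ y, F y) ^ n := by
  rw [← (Equiv.arrowProdEquivProdArrow (Fin n) (fun _ => A) (fun _ => E)).sum_comp,
    Fintype.sum_pow]
  rfl

lemma sum_prod_apply (Q : E → ℝ) (n : ℕ) :
    ∑ e : Fin n → E, ∏ i, Q (e i) = (∑ e, Q e) ^ n := (Fintype.sum_pow Q n).symm

lemma sum_margE (F : A × E → ℝ) : ∑ e, margE F e = ∑ x, F x :=
  (Fintype.sum_prod_type_right' fun a e => F (a, e)).symm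

lemma sum_mul_margE (F : A × E → ℝ) (q : E → ℝ) :
    ∑ x : A × E, F x * q x.2 = ∑ e, margE F e * q e := by
  simp only [margE, Finset.sum_mul]
  exact Fintype.sum_prod_type_right' fun a e => F (a, e) * q e

lemma IsDist.margE {F : A × E → ℝ} (hF : IsDist F) : IsDist (margE F) :=
  ⟨margE_nonneg hF.1, by rw [sum_margE, hF.2]⟩

lemma IsDist.iid {F : A × E → ℝ} (hF : IsDist F) (n : ℕ) : IsDist (iid F n) :=
  ⟨iid_nonneg hF.1 n, by rw [sum_iid, hF.2, one_pow]⟩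

lemma IsDist.prod {Q : E → ℝ} (hQ : IsDist Q) (n : ℕ) :
    IsDist (fun e : Fin n → E => ∏ i, Q (e i)) :=
  ⟨fun _ => Finset.prod_nonneg fun _ _ => hQ.1 _, by rw [sum_prod_apply, hQ.2, one_pow]⟩

end Product

/-! ### Law of large numbers by the Chernoff method. -/

section LawOfLargeNumbers

/-- The moment generating function is `1` at `0` with derivative the negative mean, so it dips below
`1` just to the right. -/
lemma exists_sum_mul_exp_lt_one {X : Type*} [Fintype X] {W Y : X → ℝ} (hW : IsDist W)
    (h : ∑ x, W x * Y x < 0) : ∃ θ > 0, ∑ x, W x * Real.exp (θ * Y x) < 1 := by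
  have hd : HasDerivAt (fun θ : ℝ => ∑ x, W x * Real.exp (θ * Y x)) (∑ x, W x * Y x) 0 := by
    have h1 : ∀ x ∈ (Finset.univ : Finset X),
        HasDerivAt (fun θ : ℝ => W x * Real.exp (θ * Y x)) (W x * Y x) 0 := by
      intro x _
      have := (((hasDerivAt_id (0 : ℝ)).mul_const (Y x)).exp).const_mul (W x)
      simpa using this
    exact HasDerivAt.fun_sum h1
  have h2 := (hasDerivAt_iff_tendsto_slope.1 hd).eventually (eventually_lt_nhds h)
  have h3 : ∀ᶠ θ in 𝓝[>] (0 : ℝ),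
      slope (fun θ : ℝ => ∑ x, W x * Real.exp (θ * Y x)) 0 θ < 0 :=
    h2.filter_mono (nhdsWithin_mono _ fun θ hθ => ne_of_gt hθ)
  obtain ⟨θ, hθ, hpos⟩ := (h3.and self_mem_nhdsWithin).exists
  refine ⟨θ, hpos, ?_⟩
  have hpos' : (0 : ℝ) < θ := hpos
  rw [slope_def_field, sub_zero, div_lt_iff₀ hpos'] at hθ
  simp only [zero_mul, Real.exp_zero, mul_one, hW.2] at hθ
  linarith

variable {A E : Type*} [Fintype A] [Fintype E]

/-- By Markov's inequality for the exponential moment, the tail is at most the `n`-th power of a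
number below `1`. -/
lemma tendsto_iid_upper_tail {W Y : A × E → ℝ} (hW : IsDist W) {μ : ℝ}
    (h : ∑ x, W x * Y x < μ) :
    Tendsto (fun n : ℕ => ∑ x : (Fin n → A) × (Fin n → E),
      if n * μ < ∑ i, Y (x.1 i, x.2 i) then iid W n x else 0) atTop (𝓝 0) := by
  have h' : ∑ x, W x * (Y x - μ) < 0 := by
    simp only [mul_sub, Finset.sum_sub_distrib, ← Finset.sum_mul, hW.2]
    linarith
  obtain ⟨θ, hθ, hlt⟩ := exists_sum_mul_exp_lt_one hW h'
  have h0 : 0 ≤ ∑ x, W x * Real.exp (θ * (Y x - μ)) :=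
    Finset.sum_nonneg fun x _ => mul_nonneg (hW.1 x) (Real.exp_pos _).le
  refine squeeze_zero (fun n => Finset.sum_nonneg fun x _ => ?_) (fun n => ?_)
    (tendsto_pow_atTop_nhds_zero_of_lt_one h0 hlt)
  · split_ifs
    exacts [iid_nonneg hW.1 n x, le_rfl]
  · rw [← sum_iid (fun x => W x * Real.exp (θ * (Y x - μ)))]
    refine Finset.sum_le_sum fun x _ => ?_
    have he : iid (fun x => W x * Real.exp (θ * (Y x - μ))) n x =
        iid W n x * Real.exp (θ * (∑ i, Y (x.1 i, x.2 i) - n * μ)) := by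
      simp only [iid, Finset.prod_mul_distrib, ← Real.exp_sum, ← Finset.mul_sum,
        Finset.sum_sub_distrib, Finset.sum_const, Finset.card_univ, Fintype.card_fin,
        nsmul_eq_mul]
    rw [he]
    split_ifs with hx
    · refine le_mul_of_one_le_right (iid_nonneg hW.1 n x) (Real.one_le_exp ?_)
      exact mul_nonneg hθ.le (by linarith)
    · exact mul_nonneg (iid_nonneg hW.1 n x) (Real.exp_pos _).le

/-- Sequences of positive `W`-probability whose empirical sums of `U` and `V` are at most
`n * μ` and `n * ν`. -/
noncomputable def typicalSet (W U V : A × E → ℝ) (μ ν : ℝ) (n : ℕ) :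
    Finset ((Fin n → A) × (Fin n → E)) :=
  Finset.univ.filter fun x => 0 < iid W n x ∧ ∑ i, U (x.1 i, x.2 i) ≤ n * μ ∧
    ∑ i, V (x.1 i, x.2 i) ≤ n * ν

lemma eventually_half_le_typicalSet {W U V : A × E → ℝ} (hW : IsDist W) {μ ν : ℝ}
    (hU : ∑ x, W x * U x < μ) (hV : ∑ x, W x * V x < ν) :
    ∀ᶠ n : ℕ in atTop, 1 / 2 ≤ ∑ x ∈ typicalSet W U V μ ν n, iid W n x := by
  have h := (tendsto_iid_upper_tail hW hU).add (tendsto_iid_upper_tail hW hV)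
  rw [add_zero] at h
  filter_upwards [h.eventually (eventually_lt_nhds (show (0 : ℝ) < 1 / 2 by norm_num))]
    with n hn
  have h1 : ∑ x, iid W n x ≤ ∑ x ∈ typicalSet W U V μ ν n, iid W n x +
      ((∑ x : (Fin n → A) × (Fin n → E),
        if n * μ < ∑ i, U (x.1 i, x.2 i) then iid W n x else 0) +
      ∑ x : (Fin n → A) × (Fin n → E),
        if n * ν < ∑ i, V (x.1 i, x.2 i) then iid W n x else 0) := by
    rw [typicalSet, Finset.sum_filter, ← Finset.sum_add_distrib, ← Finset.sum_add_distrib]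
    refine Finset.sum_le_sum fun x _ => ?_
    have h0 := iid_nonneg hW.1 n x
    rcases h0.eq_or_lt with h0 | h0
    · rw [← h0]; simp
    · by_cases hu : ∑ i, U (x.1 i, x.2 i) ≤ n * μ <;>
      by_cases hv : ∑ i, V (x.1 i, x.2 i) ≤ n * ν <;>
      simp [h0, hu, hv, not_lt.2, lt_of_not_ge, h0.le]
  rw [sum_iid, hW.2, one_pow] at h1
  linarith

end LawOfLargeNumbers

/-! ### One-shot estimates: truncation and typical-set weight. -/

section OneShot

variable {A E : Type*}

open Classical in
/-- The truncation of `P` to the set where `P ≤ t Q`. -/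
noncomputable def truncate (P : A × E → ℝ) (Q : E → ℝ) (t : ℝ) (x : A × E) : ℝ :=
  if P x ≤ t * Q x.2 then P x else 0

lemma truncate_nonneg {P : A × E → ℝ} (hP : ∀ x, 0 ≤ P x) (Q : E → ℝ) (t : ℝ) (x : A × E) :
    0 ≤ truncate P Q t x := by
  rw [truncate]; split_ifs
  exacts [hP x, le_rfl]

lemma truncate_le_self {P : A × E → ℝ} (hP : ∀ x, 0 ≤ P x) (Q : E → ℝ) (t : ℝ) (x : A × E) :
    truncate P Q t x ≤ P x := by
  rw [truncate]; split_ifs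
  exacts [le_rfl, hP x]

lemma truncate_le {Q : E → ℝ} {t : ℝ} (hQ : ∀ e, 0 ≤ Q e) (ht : 0 ≤ t) (P : A × E → ℝ)
    (x : A × E) : truncate P Q t x ≤ t * Q x.2 := by
  rw [truncate]; split_ifs with h
  exacts [h, mul_nonneg ht (hQ _)]

variable [Fintype A] [Fintype E]

lemma l1Dist_nonneg (P P' : A × E → ℝ) : 0 ≤ l1Dist P P' :=
  Finset.sum_nonneg fun _ _ => abs_nonneg _

lemma l1Dist_le_two {P P' : A × E → ℝ} (hP : IsDist P) (hP' : IsSubDist P') :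
    l1Dist P P' ≤ 2 := by
  have h : l1Dist P P' ≤ ∑ x, (P x + P' x) := Finset.sum_le_sum fun x _ => by
    rw [abs_le]; constructor <;> linarith [hP.1 x, hP'.1 x]
  rw [Finset.sum_add_distrib, hP.2] at h
  linarith [hP'.2]

lemma sum_sub_le_l1Dist (P P' : A × E → ℝ) (T : Finset (A × E)) :
    ∑ x ∈ T, P x - ∑ x ∈ T, P' x ≤ l1Dist P P' := by
  rw [← Finset.sum_sub_distrib]
  exact (Finset.sum_le_sum fun x _ => le_abs_self _).trans
    (Finset.sum_le_sum_of_subset_of_nonneg (Finset.subset_univ T) fun _ _ _ => abs_nonneg _)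

/-- The total `Q`-weight of a set on which the conditional distribution of `W` is at least `b`. -/
lemma mul_sum_le_one {W : A × E → ℝ} {Q : E → ℝ} {b : ℝ} {T : Finset (A × E)}
    (hW : ∀ x, 0 ≤ W x) (hQ : IsDist Q) (hT : ∀ x ∈ T, 0 < W x)
    (hb : ∀ x ∈ T, margE W x.2 * b ≤ W x) :
    b * ∑ x ∈ T, Q x.2 ≤ 1 := by
  -- The right side is `W(a|e) Q(e)`, whose sum over all pairs is at most the total mass of `Q`.
  have h1 : ∀ x ∈ T, b * Q x.2 ≤ W x * (Q x.2 / margE W x.2) := by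
    intro x hx
    have hm : 0 < margE W x.2 := (hT x hx).trans_le (le_margE hW x)
    rw [mul_div_assoc', le_div_iff₀ hm]
    nlinarith [hb x hx, hQ.1 x.2]
  calc b * ∑ x ∈ T, Q x.2 ≤ ∑ x ∈ T, W x * (Q x.2 / margE W x.2) := by
        rw [Finset.mul_sum]; exact Finset.sum_le_sum h1
    _ ≤ ∑ x, W x * (Q x.2 / margE W x.2) :=
        Finset.sum_le_sum_of_subset_of_nonneg (Finset.subset_univ T) fun x _ _ =>
          mul_nonneg (hW x) (div_nonneg (hQ.1 _) (margE_nonneg hW _))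
    _ = ∑ e, margE W e * (Q e / margE W e) := sum_mul_margE W fun e => Q e / margE W e
    _ ≤ ∑ e, Q e := Finset.sum_le_sum fun e _ => by
        rcases eq_or_ne (margE W e) 0 with h | h
        · simpa [h] using hQ.1 e
        · rw [mul_div_cancel₀ _ h]
    _ = 1 := hQ.2

lemma isSubDist_truncate {P : A × E → ℝ} (hP : IsDist P) (Q : E → ℝ) (t : ℝ) :
    IsSubDist (truncate P Q t) :=
  ⟨truncate_nonneg hP.1 Q t,
    (Finset.sum_le_sum fun x _ => truncate_le_self hP.1 Q t x).trans hP.2.le⟩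

/-- Mass is lost only where `P > t Q`, and there `(P / (t Q)) ^ s ≥ 1` may be inserted as a factor.
-/
lemma l1Dist_truncate_le {P : A × E → ℝ} {Q : E → ℝ} {s t : ℝ} (hP : ∀ x, 0 ≤ P x)
    (hQ : ∀ e, 0 ≤ Q e) (hPQ : ∀ x, Q x.2 = 0 → P x = 0) (hs : 0 < s) (ht : 0 < t) :
    l1Dist P (truncate P Q t) ≤ t ^ (-s) * ∑ x : A × E, P x ^ (1 + s) * Q x.2 ^ (-s) := by
  rw [l1Dist, Finset.mul_sum]
  refine Finset.sum_le_sum fun x _ => ?_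
  have hnn : 0 ≤ t ^ (-s) * (P x ^ (1 + s) * Q x.2 ^ (-s)) :=
    mul_nonneg (Real.rpow_nonneg ht.le _)
      (mul_nonneg (Real.rpow_nonneg (hP x) _) (Real.rpow_nonneg (hQ _) _))
  rw [truncate]
  split_ifs with h
  · simpa using hnn
  · push Not at h
    have hq : 0 < Q x.2 := (hQ _).lt_of_ne fun h0 => by
      rw [hPQ x h0.symm, ← h0] at h; simp at h
    have htq : 0 < t * Q x.2 := mul_pos ht hq
    have hp : 0 < P x := htq.trans h
    rw [sub_zero, abs_of_pos hp, Real.rpow_add hp, Real.rpow_one]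
    have h1 : t ^ (-s) * (P x * P x ^ s * Q x.2 ^ (-s)) = P x * (P x / (t * Q x.2)) ^ s := by
      rw [Real.div_rpow hp.le htq.le, Real.mul_rpow ht.le hq.le, Real.rpow_neg ht.le,
        Real.rpow_neg hq.le]
      field_simp
    rw [h1]
    exact le_mul_of_one_le_right hp.le
      (Real.one_le_rpow ((one_le_div htq).2 h.le) hs.le)

end OneShot

/-! ### Estimates for `η`. -/

section Eta

/-- Split `x (y - log x)` as `x (y - log x₀) + x (log x₀ - log x)`; the last term is at most `x₀ -
x`. This stands in for monotonicity of `η` in `x`. -/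
lemma eta_le {x x₀ y : ℝ} (hx : 0 ≤ x) (hxx : x ≤ x₀) (hy : 0 ≤ y - Real.log x₀) :
    eta x y ≤ x₀ * (y - Real.log x₀ + 1) := by
  rcases hx.eq_or_lt with rfl | hx
  · simp only [eta]
    have : 0 ≤ x₀ * (y - Real.log x₀ + 1) := mul_nonneg hxx (by linarith)
    simpa using this
  · have hx₀ : 0 < x₀ := hx.trans_le hxx
    have h1 := Real.log_le_sub_one_of_pos (div_pos hx₀ hx)
    rw [Real.log_div hx₀.ne' hx.ne'] at h1
    have h2 : x * (Real.log x₀ - Real.log x) ≤ x₀ - x := by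
      calc _ ≤ x * (x₀ / x - 1) := mul_le_mul_of_nonneg_left h1 hx.le
        _ = _ := by field_simp
    have h3 : x * (y - Real.log x₀) ≤ x₀ * (y - Real.log x₀) :=
      mul_le_mul_of_nonneg_right hxx hy
    rw [eta]
    linarith

/-- The range `[0, 2]` is that of the `ℓ₁` distance; on it `y - log x ≥ 1`. -/
lemma le_eta {x y : ℝ} (hx : 0 ≤ x) (hx2 : x ≤ 2) (hy : 1 + Real.log 2 ≤ y) : x ≤ eta x y := by
  rcases hx.eq_or_lt with rfl | hx
  · simp [eta]
  · have h1 : Real.log x ≤ Real.log 2 := Real.log_le_log hx hx2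
    rw [eta]
    nlinarith

end Eta

/-! ### Upper bounds on the smoothing quantities. -/

section Direct

variable {A E : Type*}

lemma iid_eq_zero_of_prod_eq_zero {P : A × E → ℝ} {Q : E → ℝ} (hPQ : ∀ x, Q x.2 = 0 → P x = 0)
    {n : ℕ} (x : (Fin n → A) × (Fin n → E)) (h : ∏ i, Q (x.2 i) = 0) : iid P n x = 0 := by
  obtain ⟨i, hi, h0⟩ := Finset.prod_eq_zero_iff.1 h
  exact Finset.prod_eq_zero hi (hPQ (x.1 i, x.2 i) h0)

variable [Fintype A] [Fintype E]

lemma sum_iid_rpow {P : A × E → ℝ} {Q : E → ℝ} (hP : ∀ x, 0 ≤ P x) (hQ : ∀ e, 0 ≤ Q e)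
    (s : ℝ) (n : ℕ) :
    ∑ x : (Fin n → A) × (Fin n → E), iid P n x ^ (1 + s) * (∏ i, Q (x.2 i)) ^ (-s) =
      (∑ x : A × E, P x ^ (1 + s) * Q x.2 ^ (-s)) ^ n := by
  rw [← sum_iid (fun x : A × E => P x ^ (1 + s) * Q x.2 ^ (-s))]
  refine Finset.sum_congr rfl fun x _ => ?_
  rw [iid, iid, ← Real.finsetProd_rpow _ _ fun _ _ => hP _,
    ← Real.finsetProd_rpow _ _ fun _ _ => hQ _, Finset.prod_mul_distrib]

/-- The truncation error of the `n`-fold extension at the threshold `exp (-n τ)`. -/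
lemma l1Dist_truncate_iid_le {P : A × E → ℝ} {Q : E → ℝ} {s H : ℝ} (hP : ∀ x, 0 ≤ P x)
    (hQ : ∀ e, 0 ≤ Q e) (hPQ : ∀ x, Q x.2 = 0 → P x = 0) (hs : 0 < s)
    (hG : ∑ x : A × E, P x ^ (1 + s) * Q x.2 ^ (-s) = Real.exp (-(s * H))) (τ : ℝ) (n : ℕ) :
    l1Dist (iid P n) (truncate (iid P n) (fun e => ∏ i, Q (e i)) (Real.exp (-(n * τ)))) ≤
      Real.exp (-(n * (s * (H - τ)))) := by
  refine (l1Dist_truncate_le (iid_nonneg hP n) (fun e => Finset.prod_nonneg fun _ _ => hQ _)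
    (iid_eq_zero_of_prod_eq_zero hPQ) hs (Real.exp_pos _)).trans_eq ?_
  rw [sum_iid_rpow hP hQ, hG, ← Real.exp_mul, ← Real.exp_nat_mul, ← Real.exp_add]
  congr 1
  ring

lemma deltaDMin_iid_le {P : A × E → ℝ} {Q : E → ℝ} {s H : ℝ} (hP : IsDist P) (hQ : IsDist Q)
    (hPQ : ∀ x, Q x.2 = 0 → P x = 0) (hs : 0 < s)
    (hG : ∑ x : A × E, P x ^ (1 + s) * Q x.2 ^ (-s) = Real.exp (-(s * H))) (R ε : ℝ) (n : ℕ) :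
    deltaDMin (Real.exp (n * R)) ε (iid P n) ≤
      (((2 + √ε) * Real.exp (-(n * (s / (1 + 2 * s) * (H - R)))) : ℝ) : EReal) := by
  -- The solution of `s (H - τ) = (τ - R) / 2`, which equalises the decay of the two terms.
  set τ := (2 * s * H + R) / (1 + 2 * s) with hτ
  have hs' : (1 + 2 * s) ≠ 0 := by positivity
  refine (deltaDMin_le (hQ.prod n) (isSubDist_truncate (hP.iid n) _ _) (Real.exp_pos _).le
    (truncate_le (hQ.prod n).1 (Real.exp_pos (-(n * τ))).le _)).trans ?_
  have h1 := l1Dist_truncate_iid_le hP.1 hQ.1 hPQ hs hG τ n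
  have h2 : s * (H - τ) = s / (1 + 2 * s) * (H - R) := by rw [hτ]; field_simp; ring
  have h3 : √ε * √(Real.exp (n * R)) * √(Real.exp (-(n * τ))) =
      √ε * Real.exp (-(n * (s / (1 + 2 * s) * (H - R)))) := by
    rw [mul_assoc, ← Real.sqrt_mul (Real.exp_pos _).le, ← Real.exp_add, ← Real.exp_half, hτ]
    congr 2
    field_simp
    ring
  rw [h2] at h1
  rw [EReal.coe_le_coe_iff, h3]
  linarith

/-- The choice `P' = 0`; it accounts for the term `s = 0` of the supremum. -/
lemma deltaDMin_le_two {P : A × E → ℝ} (hP : IsDist P) (M ε : ℝ) :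
    deltaDMin M ε P ≤ ((2 : ℝ) : EReal) := by
  refine (deltaDMin_le (P' := fun _ => 0) (t := 0) hP.margE ⟨fun _ => le_rfl, by simp⟩ le_rfl
    (fun x => by simp)).trans (le_of_eq ?_)
  simp only [l1Dist, sub_zero, abs_of_nonneg (hP.1 _), hP.2, Real.sqrt_zero]
  norm_num

lemma deltaIMin_iid_le {P : A × E → ℝ} {s H R ε : ℝ} (hP : IsDist P) (hs : 0 < s)
    (hG : ∑ x : A × E, P x ^ (1 + s) * margE P x.2 ^ (-s) = Real.exp (-(s * H)))
    (hε : 0 ≤ ε) (hR : 0 ≤ R) (hH : R ≤ H) (n : ℕ) :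
    deltaIMin (Real.exp (n * R)) ε (iid P n) ≤
      ((Real.exp (-(n * (s / (1 + s) * (H - R)))) *
        (n * (R + s / (1 + s) * (H - R)) + (1 + ε)) : ℝ) : EReal) := by
  -- Here the balance is `s (H - τ) = τ - R`, since the min-entropy enters without the factor `1/2`.
  set τ := (s * H + R) / (1 + s) with hτ
  set c := s / (1 + s) * (H - R) with hc
  have hc0 : 0 ≤ c := mul_nonneg (by positivity) (by linarith)
  have hs' : (1 + s) ≠ 0 := by positivity
  have hPQ : ∀ x : A × E, margE P x.2 = 0 → P x = 0 := fun x hx =>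
    le_antisymm ((le_margE hP.1 x).trans_eq hx) (hP.1 x)
  have hm : margE (iid P n) = fun e => ∏ i, margE P (e i) := funext (margE_iid P n)
  refine (deltaIMin_le (Real.exp_pos _).le hε (isSubDist_truncate (hP.iid n) _ _)
    (fun e => Finset.sum_le_sum fun a _ => truncate_le_self (hP.iid n).1 _ _ (a, e))
    (Real.exp_pos _).le
    (truncate_le (hP.iid n).margE.1 (Real.exp_pos (-(n * τ))).le _)).trans ?_
  have h1 := l1Dist_truncate_iid_le hP.1 hP.margE.1 hPQ hs hG τ n
  rw [← hm] at h1
  have h2 : s * (H - τ) = c := by rw [hτ, hc]; field_simp; ring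
  have h3 : ε * Real.exp (n * R) * Real.exp (-(n * τ)) = ε * Real.exp (-(n * c)) := by
    rw [mul_assoc, ← Real.exp_add, hτ, hc]
    congr 2
    field_simp
    ring
  rw [h2] at h1
  have h4 := eta_le (y := Real.log (Real.exp (n * R))) (l1Dist_nonneg _ _) h1
    (by rw [Real.log_exp, Real.log_exp]; nlinarith [mul_nonneg n.cast_nonneg hR,
      mul_nonneg (n.cast_nonneg : (0 : ℝ) ≤ n) hc0])
  rw [EReal.coe_le_coe_iff, h3]
  refine (add_le_add_left h4 _).trans_eq ?_
  rw [Real.log_exp, Real.log_exp]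
  ring

lemma deltaIMin_le_log {P : A × E → ℝ} {M ε : ℝ} (hP : IsDist P) (hM : 0 ≤ M) (hε : 0 ≤ ε) :
    deltaIMin M ε P ≤ ((Real.log M : ℝ) : EReal) := by
  refine (deltaIMin_le (P' := fun _ => 0) (t := 0) hM hε ⟨fun _ => le_rfl, by simp⟩
    (fun e => by simpa [margE] using hP.margE.1 e) le_rfl (fun x => by simp)).trans (le_of_eq ?_)
  simp only [l1Dist, sub_zero, abs_of_nonneg (hP.1 _), hP.2, eta]
  norm_num

end Direct

/-! ### Lower bounds on the smoothing quantities by change of measure. -/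

section Converse

variable {A E : Type*} [Fintype A] [Fintype E]

lemma exp_neg_log_sub_log {u v : ℝ} (hu : 0 < u) (hv : 0 < v) :
    v = u * Real.exp (-(Real.log u - Real.log v)) := by
  rw [neg_sub, Real.exp_sub, Real.exp_log hu, Real.exp_log hv]
  field_simp

lemma pos_of_mem_typicalSet {W U V : A × E → ℝ} {μ ν : ℝ} {n : ℕ} (hW : ∀ x, 0 ≤ W x)
    {x : (Fin n → A) × (Fin n → E)} (hx : x ∈ typicalSet W U V μ ν n) (i : Fin n) :
    0 < W (x.1 i, x.2 i) := by
  refine (hW _).lt_of_ne' fun h => ?_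
  have := (Finset.mem_filter.1 hx).2.1
  rw [iid, Finset.prod_eq_zero (Finset.mem_univ i) h] at this
  exact this.false

/-- The `P`-probability of the typical set of `W`, for `U = log W - log P`. -/
lemma half_exp_le_sum_typicalSet {P W V : A × E → ℝ} {μ ν : ℝ} {n : ℕ}
    (hP : ∀ x, 0 ≤ P x) (hW : ∀ x, 0 ≤ W x) (hWP : ∀ x, P x = 0 → W x = 0)
    (h : 1 / 2 ≤ ∑ x ∈ typicalSet W (fun x => Real.log (W x) - Real.log (P x)) V μ ν n,
      iid W n x) :
    Real.exp (-(n * μ)) / 2 ≤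
      ∑ x ∈ typicalSet W (fun x => Real.log (W x) - Real.log (P x)) V μ ν n, iid P n x := by
  have h1 : ∀ x ∈ typicalSet W (fun x => Real.log (W x) - Real.log (P x)) V μ ν n,
      iid W n x * Real.exp (-(n * μ)) ≤ iid P n x := fun x hx =>
    prod_mul_exp_le (V := fun x => Real.log (W x) - Real.log (P x)) hW (fun i => by
      have hw := pos_of_mem_typicalSet hW hx i
      exact exp_neg_log_sub_log hw ((hP _).lt_of_ne' fun h0 => hw.ne' (hWP _ h0)))
      (Finset.mem_filter.1 hx).2.2.1
  refine le_trans ?_ (Finset.sum_le_sum h1)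
  rw [← Finset.sum_mul]
  nlinarith [Real.exp_pos (-(n * μ))]

/-- On the typical set `T`, every `Q` has weight at most `exp (n ν)`, so `P'` has mass at most `t
exp (n ν)`, against at least `exp (-n μ) / 2` for the i.i.d. law. -/
lemma eventually_le_deltaDMin {P W : A × E → ℝ} {μ ν R ε c : ℝ} (hP : IsDist P)
    (hW : IsDist W) (hWP : ∀ x, P x = 0 → W x = 0) (hε : 0 < ε)
    (hμ : ∑ x, W x * (Real.log (W x) - Real.log (P x)) < μ)
    (hν : ∑ x, W x * (Real.log (margE W x.2) - Real.log (W x)) < ν)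
    (hc : μ ≤ c) (hc' : (μ + ν - R) / 2 ≤ c) :
    ∀ᶠ n : ℕ in atTop, ((min (1 / 2) (√ε / 2) * Real.exp (-(n * c)) : ℝ) : EReal) ≤
      deltaDMin (Real.exp (n * R)) ε (iid P n) := by
  filter_upwards [eventually_half_le_typicalSet hW hμ hν] with n hn
  refine le_deltaDMin (Real.exp_pos _) hε fun Q hQ P' hP' t ht hle => ?_
  have hα := half_exp_le_sum_typicalSet hP.1 hW.1 hWP hn
  set T := typicalSet W (fun x => Real.log (W x) - Real.log (P x))
    (fun x => Real.log (margE W x.2) - Real.log (W x)) μ ν n with hT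
  have hβ := mul_sum_le_one (T := T) (b := Real.exp (-(n * ν))) (hW.iid n).1 hQ
    (fun x hx => (Finset.mem_filter.1 hx).2.1) (fun x hx => by
      rw [margE_iid]
      exact prod_mul_exp_le (G := fun x => margE W x.2)
        (V := fun x => Real.log (margE W x.2) - Real.log (W x)) (fun y => margE_nonneg hW.1 _)
        (fun i => by
          have hw := pos_of_mem_typicalSet hW.1 hx i
          exact exp_neg_log_sub_log (hw.trans_le (le_margE hW.1 _)) hw)
        (Finset.mem_filter.1 hx).2.2.2)
  have hl := sum_sub_le_l1Dist (iid P n) P' T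
  have hP'T : ∑ x ∈ T, P' x ≤ t * ∑ x ∈ T, Q x.2 := by
    rw [Finset.mul_sum]; exact Finset.sum_le_sum fun x _ => hle x
  have hnc : (0 : ℝ) ≤ n := n.cast_nonneg
  have hrest : 0 ≤ √ε * √(Real.exp (n * R)) * √t := by positivity
  have hl0 := l1Dist_nonneg (iid P n) P'
  -- Below this threshold `P'` has at most half of the guaranteed mass on `T`; above it, `√t` alone
  -- makes the second term large.
  by_cases hcase : t ≤ Real.exp (-(n * (μ + ν))) / 4
  · have h1 : t * ∑ x ∈ T, Q x.2 ≤ Real.exp (-(n * μ)) / 4 := by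
      have hS : 0 ≤ ∑ x ∈ T, Q x.2 := Finset.sum_nonneg fun x _ => hQ.1 _
      calc t * ∑ x ∈ T, Q x.2 ≤ Real.exp (-(n * (μ + ν))) / 4 * ∑ x ∈ T, Q x.2 :=
            mul_le_mul_of_nonneg_right hcase hS
        _ = Real.exp (-(n * μ)) / 4 * (Real.exp (-(n * ν)) * ∑ x ∈ T, Q x.2) := by
            rw [mul_add, neg_add, Real.exp_add]; ring
        _ ≤ Real.exp (-(n * μ)) / 4 * 1 := mul_le_mul_of_nonneg_left hβ (by positivity)
        _ = _ := mul_one _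
    have h2 : Real.exp (-(n * c)) ≤ Real.exp (-(n * μ)) :=
      Real.exp_le_exp.2 (neg_le_neg (mul_le_mul_of_nonneg_left hc hnc))
    have h3 := mul_le_mul_of_nonneg_right (min_le_left (1 / 2) (√ε / 2))
      (Real.exp_pos (-(n * c))).le
    linarith
  · push Not at hcase
    have h1 : Real.exp (-(n * ((μ + ν) / 2))) / 2 ≤ √t := by
      refine Real.le_sqrt_of_sq_le (le_trans (le_of_eq ?_) hcase.le)
      rw [div_pow, ← Real.exp_nat_mul]
      norm_num
      ring
    have h2 : √(Real.exp (n * R)) = Real.exp (n * R / 2) := by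
      rw [Real.exp_half]
    have h3 : Real.exp (-(n * c)) ≤ Real.exp (n * R / 2) * Real.exp (-(n * ((μ + ν) / 2))) := by
      rw [← Real.exp_add]
      refine Real.exp_le_exp.2 ?_
      nlinarith [mul_le_mul_of_nonneg_left hc' hnc]
    calc min (1 / 2) (√ε / 2) * Real.exp (-(n * c))
        ≤ √ε / 2 * (Real.exp (n * R / 2) * Real.exp (-(n * ((μ + ν) / 2)))) :=
          mul_le_mul (min_le_right _ _) h3 (Real.exp_pos _).le (by positivity)
      _ = √ε * Real.exp (n * R / 2) * (Real.exp (-(n * ((μ + ν) / 2))) / 2) := by ring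
      _ ≤ √ε * √(Real.exp (n * R)) * √t := by
          rw [h2]; exact mul_le_mul_of_nonneg_left h1 (by positivity)
      _ ≤ _ := by linarith

/-- The reference marginal is fixed, so no weight count is needed: on the typical set, `t ≤ exp (-n
κ) / 2` gives `P' ≤ iid P n / 2` pointwise. -/
lemma eventually_le_deltaIMin {P W : A × E → ℝ} {μ κ R ε c : ℝ} (hP : IsDist P)
    (hW : IsDist W) (hWP : ∀ x, P x = 0 → W x = 0) (hε : 0 < ε) (hR : 0 < R)
    (hμ : ∑ x, W x * (Real.log (W x) - Real.log (P x)) < μ)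
    (hκ : ∑ x, W x * (Real.log (margE P x.2) - Real.log (P x)) < κ)
    (hc : μ ≤ c) (hc' : κ - R ≤ c) :
    ∀ᶠ n : ℕ in atTop, ((min (1 / 4) (ε / 2) * Real.exp (-(n * c)) : ℝ) : EReal) ≤
      deltaIMin (Real.exp (n * R)) ε (iid P n) := by
  have hlarge : ∀ᶠ n : ℕ in atTop, 1 + Real.log 2 ≤ n * R :=
    (tendsto_natCast_atTop_atTop.atTop_mul_const hR).eventually_ge_atTop _
  filter_upwards [eventually_half_le_typicalSet hW hμ hκ, hlarge] with n hn hnR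
  refine le_deltaIMin (Real.exp_pos _) hε (hP.iid n).margE.1 fun P' hP' t ht hle => ?_
  have hα := half_exp_le_sum_typicalSet hP.1 hW.1 hWP hn
  set T := typicalSet W (fun x => Real.log (W x) - Real.log (P x))
    (fun x => Real.log (margE P x.2) - Real.log (P x)) μ κ n with hT
  have hβ : ∀ x ∈ T, margE (iid P n) x.2 * Real.exp (-(n * κ)) ≤ iid P n x := fun x hx => by
    rw [margE_iid]
    exact prod_mul_exp_le (G := fun x => margE P x.2)
      (V := fun x => Real.log (margE P x.2) - Real.log (P x)) (fun y => margE_nonneg hP.1 _)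
      (fun i => by
        have hw := pos_of_mem_typicalSet hW.1 hx i
        have hp : 0 < P (x.1 i, x.2 i) := (hP.1 _).lt_of_ne' fun h0 => hw.ne' (hWP _ h0)
        exact exp_neg_log_sub_log (hp.trans_le (le_margE hP.1 _)) hp)
      (Finset.mem_filter.1 hx).2.2.2
  have hl := sum_sub_le_l1Dist (iid P n) P' T
  have hl0 := l1Dist_nonneg (iid P n) P'
  have heta := le_eta hl0 (l1Dist_le_two (hP.iid n) hP') (hnR.trans_eq (Real.log_exp _).symm)
  have hnc : (0 : ℝ) ≤ n := n.cast_nonneg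
  have hrest : 0 ≤ ε * Real.exp (n * R) * t := by positivity
  by_cases hcase : t ≤ Real.exp (-(n * κ)) / 2
  · have h1 : ∑ x ∈ T, P' x ≤ (∑ x ∈ T, iid P n x) / 2 := by
      rw [Finset.sum_div]
      refine Finset.sum_le_sum fun x hx => (hle x).trans ?_
      have := mul_le_mul_of_nonneg_right hcase ((hP.iid n).margE.1 x.2)
      linarith [hβ x hx]
    have h2 : Real.exp (-(n * c)) ≤ Real.exp (-(n * μ)) :=
      Real.exp_le_exp.2 (neg_le_neg (mul_le_mul_of_nonneg_left hc hnc))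
    have h3 := mul_le_mul_of_nonneg_right (min_le_left (1 / 4) (ε / 2))
      (Real.exp_pos (-(n * c))).le
    linarith
  · push Not at hcase
    have h3 : Real.exp (-(n * c)) ≤ Real.exp (n * R) * Real.exp (-(n * κ)) := by
      rw [← Real.exp_add]
      refine Real.exp_le_exp.2 ?_
      nlinarith [mul_le_mul_of_nonneg_left hc' hnc]
    calc min (1 / 4) (ε / 2) * Real.exp (-(n * c))
        ≤ ε / 2 * (Real.exp (n * R) * Real.exp (-(n * κ))) :=
          mul_le_mul (min_le_right _ _) h3 (Real.exp_pos _).le (by positivity)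
      _ = ε * Real.exp (n * R) * (Real.exp (-(n * κ)) / 2) := by ring
      _ ≤ ε * Real.exp (n * R) * t := mul_le_mul_of_nonneg_left hcase.le (by positivity)
      _ ≤ _ := by linarith

end Converse

/-! ### Minimax for two convex functions. -/

section Minimax

/-- Two-function minimax: if the maximum of two convex functions is at least `c`, then so is some
convex combination of them. -/
lemma exists_weight_forall_le {V : Type*} [AddCommGroup V] [Module ℝ V] {C : Set V}
    (hne : C.Nonempty) {f g : V → ℝ} (hf : ConvexOn ℝ C f) (hg : ConvexOn ℝ C g) {c : ℝ}
    (h : ∀ w ∈ C, c ≤ max (f w) (g w)) :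
    ∃ l : ℝ, 0 ≤ l ∧ l ≤ 1 ∧ ∀ w ∈ C, c ≤ (1 - l) * f w + l * g w := by
  -- The upward closure of the image of `(f, g)` is convex and misses the open quadrant below `(c,
  -- c)`. The coefficients of a separating functional, normalised, are the weights.
  set t : Set (ℝ × ℝ) := {p | ∃ w ∈ C, f w ≤ p.1 ∧ g w ≤ p.2} with ht
  have htc : Convex ℝ t := by
    rintro p ⟨w, hw, hp1, hp2⟩ q ⟨w', hw', hq1, hq2⟩ a b ha hb hab
    refine ⟨a • w + b • w', hf.1 hw hw' ha hb hab, ?_, ?_⟩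
    · refine (hf.2 hw hw' ha hb hab).trans ?_
      simp only [smul_eq_mul, Prod.fst_add, Prod.smul_fst]
      gcongr
    · refine (hg.2 hw hw' ha hb hab).trans ?_
      simp only [smul_eq_mul, Prod.snd_add, Prod.smul_snd]
      gcongr
  obtain ⟨φ, u, hφ1, hφ2⟩ := geometric_hahn_banach_open
    ((convex_Iio c).prod (convex_Iio c)) (isOpen_Iio.prod isOpen_Iio) htc
    (Set.disjoint_left.2 fun p hp ⟨w, hw, h1, h2⟩ =>
      (h w hw).not_gt (max_lt (h1.trans_lt hp.1) (h2.trans_lt hp.2)))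
  obtain ⟨w₀, hw₀⟩ := hne
  set α := φ (1, 0)
  set β := φ (0, 1)
  have hφ : ∀ x y : ℝ, φ (x, y) = x * α + y * β := fun x y => by
    have : ((x, y) : ℝ × ℝ) = x • (1, 0) + y • (0, 1) := by simp
    rw [this, map_add, map_smul, map_smul, smul_eq_mul, smul_eq_mul]
  have hlow : ∀ x y : ℝ, x < c → y < c → x * α + y * β < u := fun x y hx hy => by
    rw [← hφ]; exact hφ1 (x, y) ⟨hx, hy⟩
  have hup : ∀ w ∈ C, ∀ x y : ℝ, f w ≤ x → g w ≤ y → u ≤ x * α + y * β :=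
    fun w hw x y hx hy => by rw [← hφ]; exact hφ2 (x, y) ⟨w, hw, hx, hy⟩
  set m := max (f w₀) (g w₀)
  have hfm : f w₀ ≤ m := le_max_left _ _
  have hgm : g w₀ ≤ m := le_max_right _ _
  -- A negative coefficient would send the functional to `-∞` along the upward closed set; the
  -- witness goes far enough to violate the bound `u`.
  have hα : 0 ≤ α := by
    by_contra hneg
    push Not at hneg
    have hmm := hup w₀ hw₀ (m + (|u| + |m * α + m * β| + 1) / -α) m
      (hfm.trans (le_add_of_nonneg_right (by have := neg_pos.2 hneg; positivity))) hgm
    have h6 : (|u| + |m * α + m * β| + 1) / -α * α =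
      -(|u| + |m * α + m * β| + 1) := by
      rw [div_neg, neg_mul, div_mul_cancel₀ _ hneg.ne]
    have := neg_abs_le u
    have := le_abs_self (m * α + m * β)
    nlinarith
  have hβ : 0 ≤ β := by
    by_contra hneg
    push Not at hneg
    have hmm := hup w₀ hw₀ m (m + (|u| + |m * α + m * β| + 1) / -β) hfm
      (hgm.trans (le_add_of_nonneg_right (by have := neg_pos.2 hneg; positivity)))
    have h6 : (|u| + |m * α + m * β| + 1) / -β * β =
      -(|u| + |m * α + m * β| + 1) := by
      rw [div_neg, neg_mul, div_mul_cancel₀ _ hneg.ne]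
    have := neg_abs_le u
    have := le_abs_self (m * α + m * β)
    nlinarith
  have hαβ : 0 < α + β := by
    by_contra hneg
    have h1 : α = 0 := by linarith
    have h2 : β = 0 := by linarith
    have h3 := hlow (c - 1) (c - 1) (by linarith) (by linarith)
    have h4 := hup w₀ hw₀ _ _ le_rfl le_rfl
    rw [h1, h2] at h3 h4
    linarith
  -- The corner `(c, c)` is approached along the diagonal from inside the open quadrant.
  have hu : c * (α + β) ≤ u := by
    refine le_of_forall_pos_lt_add fun η hη => ?_
    have := hlow (c - η / (2 * (α + β))) (c - η / (2 * (α + β)))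
      (sub_lt_self _ (by positivity)) (sub_lt_self _ (by positivity))
    have h1 : η / (2 * (α + β)) * (α + β) = η / 2 := by field_simp
    nlinarith
  refine ⟨β / (α + β), by positivity, (div_le_one hαβ).2 (by linarith), fun w hw => ?_⟩
  have h1 := hup w hw _ _ le_rfl le_rfl
  have h2 : (1 - β / (α + β)) * f w + β / (α + β) * g w = (f w * α + g w * β) / (α + β) := by
    field_simp
    ring
  rw [h2, le_div_iff₀ hαβ]
  linarith

/-- Weight `1` would correspond to `s = ∞`, outside the supremum. As `f ≥ 0`, the slack between `c`
and `c'` allows the weight `c / c'` instead. -/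
lemma exists_weight_lt_one_forall_le {V : Type*} [AddCommGroup V] [Module ℝ V] {C : Set V}
    (hne : C.Nonempty) {f g : V → ℝ} (hf : ConvexOn ℝ C f) (hg : ConvexOn ℝ C g)
    (hf0 : ∀ w ∈ C, 0 ≤ f w) {c c' : ℝ} (hc : 0 < c) (hcc : c < c')
    (h : ∀ w ∈ C, c' ≤ max (f w) (g w)) :
    ∃ l : ℝ, 0 ≤ l ∧ l < 1 ∧ ∀ w ∈ C, c ≤ (1 - l) * f w + l * g w := by
  obtain ⟨l, h0, h1, hl⟩ := exists_weight_forall_le hne hf hg h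
  rcases h1.lt_or_eq with h1 | rfl
  · exact ⟨l, h0, h1, fun w hw => hcc.le.trans (hl w hw)⟩
  · have hc' : 0 < c' := hc.trans hcc
    refine ⟨c / c', by positivity, (div_lt_one hc').2 hcc, fun w hw => ?_⟩
    have h2 : c' ≤ g w := by simpa using hl w hw
    have h3 : c ≤ c / c' * g w := by
      calc c = c / c' * c' := by field_simp
        _ ≤ _ := mul_le_mul_of_nonneg_left h2 (by positivity)
    have h4 : 0 ≤ (1 - c / c') * f w :=
      mul_nonneg (sub_nonneg.2 ((div_lt_one hc').2 hcc).le) (hf0 w hw)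
    linarith

end Minimax

/-! ### Convexity and positivity of the divergence functionals. -/

section Divergence

variable {A E : Type*} [Fintype A] [Fintype E]

/-- The distributions that are absolutely continuous with respect to `P`. -/
def absContDists (P : A × E → ℝ) : Set (A × E → ℝ) :=
  {W | IsDist W ∧ ∀ x, P x = 0 → W x = 0}

lemma convex_absContDists (P : A × E → ℝ) : Convex ℝ (absContDists P) := by
  rintro W ⟨hW, hWP⟩ W' ⟨hW', hWP'⟩ a b ha hb hab
  refine ⟨⟨fun x => ?_, ?_⟩, fun x hx => ?_⟩
  · exact add_nonneg (mul_nonneg ha (hW.1 x)) (mul_nonneg hb (hW'.1 x))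
  · simp only [Pi.add_apply, Pi.smul_apply, smul_eq_mul, Finset.sum_add_distrib,
      ← Finset.mul_sum, hW.2, hW'.2, mul_one, hab]
  · simp [hWP x hx, hWP' x hx]

lemma convexOn_sum_mul_log_sub (P : A × E → ℝ) : ConvexOn ℝ (absContDists P)
    fun W => ∑ x, W x * (Real.log (W x) - Real.log (P x)) := by
  refine ⟨convex_absContDists P, fun W hW W' hW' a b ha hb hab => ?_⟩
  simp only [smul_eq_mul, Finset.mul_sum, ← Finset.sum_add_distrib, Pi.add_apply, Pi.smul_apply]
  refine Finset.sum_le_sum fun x _ => ?_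
  have := Real.convexOn_mul_log.2 (hW.1.1 x) (hW'.1.1 x) ha hb hab
  simp only [smul_eq_mul] at this
  linarith

/-- The functional is a linear one plus `∑ W_E log W_E`, the convex `x log x` composed with the
linear marginal. -/
lemma convexOn_sum_mul_log_margE_sub (P : A × E → ℝ) : ConvexOn ℝ (absContDists P)
    fun W => ∑ x : A × E, W x * (Real.log (margE W x.2) - Real.log (P x)) := by
  have hsplit : ∀ W : A × E → ℝ,
      ∑ x : A × E, W x * (Real.log (margE W x.2) - Real.log (P x)) =
        ∑ e, margE W e * Real.log (margE W e) - ∑ x, W x * Real.log (P x) := fun W => by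
    rw [← sum_mul_margE W fun e => Real.log (margE W e), ← Finset.sum_sub_distrib]
    simp only [mul_sub]
  refine ⟨convex_absContDists P, fun W hW W' hW' a b ha hb hab => ?_⟩
  simp only [hsplit, smul_eq_mul]
  have h1 : ∑ x, (a • W + b • W') x * Real.log (P x) =
      a * ∑ x, W x * Real.log (P x) + b * ∑ x, W' x * Real.log (P x) := by
    simp only [Finset.mul_sum, ← Finset.sum_add_distrib, Pi.add_apply, Pi.smul_apply, smul_eq_mul]
    exact Finset.sum_congr rfl fun x _ => by ring
  have h2 : ∑ e, margE (a • W + b • W') e * Real.log (margE (a • W + b • W') e) ≤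
      a * ∑ e, margE W e * Real.log (margE W e) +
        b * ∑ e, margE W' e * Real.log (margE W' e) := by
    simp only [Finset.mul_sum, ← Finset.sum_add_distrib]
    refine Finset.sum_le_sum fun e _ => ?_
    have h3 : margE (a • W + b • W') e = a * margE W e + b * margE W' e := by
      simp only [margE, Finset.mul_sum, ← Finset.sum_add_distrib, Pi.add_apply, Pi.smul_apply,
        smul_eq_mul]
    have := Real.convexOn_mul_log.2 (hW.1.margE.1 e) (hW'.1.margE.1 e) ha hb hab
    simp only [smul_eq_mul] at this
    rw [h3]
    linarith
  rw [h1]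
  linarith

lemma convexOn_sum_mul {P : A × E → ℝ} (k : A × E → ℝ) : ConvexOn ℝ (absContDists P)
    fun W => ∑ x, W x * k x := by
  refine ⟨convex_absContDists P, fun W _ W' _ a b _ _ _ => le_of_eq ?_⟩
  simp only [smul_eq_mul, Finset.mul_sum, ← Finset.sum_add_distrib, Pi.add_apply, Pi.smul_apply]
  exact Finset.sum_congr rfl fun x _ => by ring

lemma divergence_nonneg {P W : A × E → ℝ} (hP : IsDist P) (hW : W ∈ absContDists P) :
    0 ≤ ∑ x, W x * (Real.log (W x) - Real.log (P x)) := by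
  have h : ∀ x ∈ Finset.univ, W x - P x ≤ W x * (Real.log (W x) - Real.log (P x)) := by
    intro x _
    rcases (hW.1.1 x).eq_or_lt with h0 | h0
    · rw [← h0]; linarith [hP.1 x]
    · have hp : 0 < P x := (hP.1 x).lt_of_ne' fun h => h0.ne' (hW.2 x h)
      have h1 := Real.log_le_sub_one_of_pos (div_pos hp h0)
      rw [Real.log_div hp.ne' h0.ne'] at h1
      have h2 : W x * (Real.log (P x) - Real.log (W x)) ≤ P x - W x := by
        calc _ ≤ W x * (P x / W x - 1) := mul_le_mul_of_nonneg_left h1 h0.le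
          _ = _ := by field_simp
      linarith
  have h1 := Finset.sum_le_sum h
  rw [Finset.sum_sub_distrib, hP.2, hW.1.2, sub_self] at h1
  exact h1

end Divergence

/-! ### Tilted distributions. -/

section Tilting

variable {A E : Type*} [Fintype A] [Fintype E]

/-- The relation `h` says that `W` is `P ^ (1 + s) * q ^ (-s)` normalised by `κ`, stated without
negative powers so that zeros of `q` cause no trouble. -/
lemma sum_rpow_of_tilted {P W : A × E → ℝ} {q : E → ℝ} {s κ : ℝ} (hs : 0 < s)
    (hq : ∀ x : A × E, 0 ≤ q x.2) (hqP : ∀ x, q x.2 = 0 → P x = 0) (hW : IsDist W)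
    (hWP : ∀ x, P x = 0 → W x = 0) (h : ∀ x, P x ^ (1 + s) = κ * (W x * q x.2 ^ s)) :
    ∑ x : A × E, P x ^ (1 + s) * q x.2 ^ (-s) = κ := by
  have h1 : ∀ x ∈ (Finset.univ : Finset (A × E)), P x ^ (1 + s) * q x.2 ^ (-s) = κ * W x := by
    intro x _
    rcases (hq x).eq_or_lt with h0 | h0
    · have hp := hqP x h0.symm
      rw [hp, hWP x hp, Real.zero_rpow (by positivity)]
      ring
    · have h2 := (Real.rpow_pos_of_pos h0 s).ne'
      rw [h x, Real.rpow_neg h0.le]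
      field_simp
  rw [Finset.sum_congr rfl h1, ← Finset.mul_sum, hW.2, mul_one]

/-- On the support of `W` the weighted sum of log-ratios is the constant `-log κ`: take the
logarithm of `h`. -/
lemma divergence_add_of_tilted {P W : A × E → ℝ} {q : E → ℝ} {s κ : ℝ} (hκ : 0 < κ)
    (hP : ∀ x, 0 ≤ P x) (hq : ∀ x : A × E, 0 ≤ q x.2) (hqP : ∀ x, q x.2 = 0 → P x = 0)
    (hW : IsDist W) (hWP : ∀ x, P x = 0 → W x = 0)
    (h : ∀ x, P x ^ (1 + s) = κ * (W x * q x.2 ^ s)) :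
    ∑ x, W x * (Real.log (W x) - Real.log (P x)) +
      s * ∑ x : A × E, W x * (Real.log (q x.2) - Real.log (P x)) = -Real.log κ := by
  rw [Finset.mul_sum, ← Finset.sum_add_distrib]
  have h1 : ∀ x ∈ (Finset.univ : Finset (A × E)),
      W x * (Real.log (W x) - Real.log (P x)) +
        s * (W x * (Real.log (q x.2) - Real.log (P x))) = W x * -Real.log κ := by
    intro x _
    rcases (hW.1 x).eq_or_lt with h0 | h0
    · rw [← h0]; ring
    · have hp : 0 < P x := (hP x).lt_of_ne' fun h => h0.ne' (hWP x h)
      have hq' : 0 < q x.2 := (hq x).lt_of_ne' fun h => hp.ne' (hqP x h)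
      have h2 := congrArg Real.log (h x)
      rw [Real.log_rpow hp, Real.log_mul hκ.ne' (by positivity),
        Real.log_mul h0.ne' (by positivity), Real.log_rpow hq'] at h2
      linear_combination -W x * h2
  rw [Finset.sum_congr rfl h1, ← Finset.sum_mul, hW.2, one_mul]

lemma IsDist.exists_pos {X : Type*} [Fintype X] {p : X → ℝ} (hp : IsDist p) : ∃ x, 0 < p x := by
  by_contra! h
  have := Finset.sum_nonpos fun x (_ : x ∈ Finset.univ) => h x
  linarith [hp.2]

/-- The tilted distribution that is optimal for `H^↑`. -/
lemma exists_tilted_up {P : A × E → ℝ} (hP : IsDist P) {s : ℝ} (hs : 0 < s) :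
    ∃ W ∈ absContDists P, ∃ κ : ℝ, 0 < κ ∧ (∀ x, margE W x.2 = 0 → P x = 0) ∧
      ∀ x, P x ^ (1 + s) = κ * (W x * margE W x.2 ^ s) := by
  set S : E → ℝ := margE fun x => P x ^ (1 + s) with hS
  have hpow : ∀ x, 0 ≤ P x ^ (1 + s) := fun x => Real.rpow_nonneg (hP.1 x) _
  have hS0 : ∀ e, 0 ≤ S e := margE_nonneg hpow
  have hSP : ∀ x : A × E, P x ^ (1 + s) ≤ S x.2 := fun x => le_margE hpow x
  have hs1 : 1 + s ≠ 0 := by positivity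
  set Z := ∑ e, S e ^ (1 / (1 + s)) with hZ
  have hZ0 : 0 < Z := by
    obtain ⟨x, hx⟩ := hP.exists_pos
    have : 0 < S x.2 := (Real.rpow_pos_of_pos hx _).trans_le (hSP x)
    exact Finset.sum_pos' (fun e _ => Real.rpow_nonneg (hS0 e) _)
      ⟨x.2, Finset.mem_univ _, Real.rpow_pos_of_pos this _⟩
  -- The required relation involves the marginal of `W` itself. Summing it over `a` gives `S = κ W_E
  -- ^ (1 + s)`, so `W_E` must be `S ^ (1 / (1 + s))` normalised, which determines `W` and `κ = Z ^
  -- (1 + s)`.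
  set W : A × E → ℝ := fun x => P x ^ (1 + s) * (S x.2 ^ (1 / (1 + s) - 1) / Z) with hW
  have hmW : ∀ e, margE W e = S e ^ (1 / (1 + s)) / Z := by
    intro e
    have h1 : margE W e = S e * (S e ^ (1 / (1 + s) - 1) / Z) := by
      rw [hS]; simp only [margE, hW, Finset.sum_mul]; rfl
    rw [h1]
    rcases (hS0 e).eq_or_lt with h0 | h0
    · rw [← h0, Real.zero_rpow (one_div_ne_zero hs1)]; ring
    · rw [Real.rpow_sub_one h0.ne']; field_simp
  have hzero : ∀ x, P x = 0 → W x = 0 := fun x hx => by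
    simp only [hW, hx, Real.zero_rpow hs1, zero_mul]
  refine ⟨W, ⟨⟨fun x => mul_nonneg (hpow x)
    (div_nonneg (Real.rpow_nonneg (hS0 _) _) hZ0.le), ?_⟩, hzero⟩, Z ^ (1 + s),
    Real.rpow_pos_of_pos hZ0 _, fun x hx => ?_, fun x => ?_⟩
  · rw [← sum_margE, Finset.sum_congr rfl fun e _ => hmW e, ← Finset.sum_div, ← hZ,
      div_self hZ0.ne']
  · rw [hmW, div_eq_zero_iff, or_iff_left hZ0.ne', Real.rpow_eq_zero (hS0 _) (by positivity)] at hx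
    have h1 := le_antisymm ((hSP x).trans_eq hx) (hpow x)
    rwa [Real.rpow_eq_zero (hP.1 x) hs1] at h1
  · rcases (hP.1 x).eq_or_lt with h0 | h0
    · rw [hzero x h0.symm, ← h0, Real.zero_rpow hs1]; ring
    · have hSx : 0 < S x.2 := (Real.rpow_pos_of_pos h0 _).trans_le (hSP x)
      rw [hmW, Real.div_rpow (Real.rpow_nonneg (hS0 _) _) hZ0.le, ← Real.rpow_mul (hS0 _)]
      have h1 : S x.2 ^ (1 / (1 + s) - 1) * S x.2 ^ (1 / (1 + s) * s) = 1 := by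
        rw [← Real.rpow_add hSx]
        have : 1 / (1 + s) - 1 + 1 / (1 + s) * s = 0 := by field_simp; ring
        rw [this, Real.rpow_zero]
      have h2 : Z ^ (1 + s) = Z * Z ^ s := by rw [Real.rpow_add hZ0, Real.rpow_one]
      have h3 : Z ^ s ≠ 0 := (Real.rpow_pos_of_pos hZ0 _).ne'
      have h4 : ∀ p a b z zs : ℝ, z ≠ 0 → zs ≠ 0 →
          z * zs * (p * (a / z) * (b / zs)) = p * (a * b) := by
        intros; field_simp
      simp only [hW]
      rw [h2, h4 _ _ _ _ _ hZ0.ne' h3, h1, mul_one]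

lemma exists_tilted_down {P : A × E → ℝ} (hP : IsDist P) {s : ℝ} (hs : 0 < s) :
    ∃ W ∈ absContDists P, ∃ κ : ℝ, 0 < κ ∧
      ∀ x, P x ^ (1 + s) = κ * (W x * margE P x.2 ^ s) := by
  have hm := hP.margE.1
  have hs1 : 1 + s ≠ 0 := by positivity
  set F : A × E → ℝ := fun x => P x ^ (1 + s) * margE P x.2 ^ (-s) with hF
  have hF0 : ∀ x, 0 ≤ F x := fun x =>
    mul_nonneg (Real.rpow_nonneg (hP.1 x) _) (Real.rpow_nonneg (hm _) _)
  have hpos : ∀ x, 0 < P x → 0 < F x := fun x hx =>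
    mul_pos (Real.rpow_pos_of_pos hx _) (Real.rpow_pos_of_pos (hx.trans_le (le_margE hP.1 x)) _)
  have hκ : 0 < ∑ x, F x := by
    obtain ⟨x, hx⟩ := hP.exists_pos
    exact Finset.sum_pos' (fun x _ => hF0 x) ⟨x, Finset.mem_univ _, hpos x hx⟩
  have hzero : ∀ x, P x = 0 → F x = 0 := fun x hx => by
    simp only [hF, hx, Real.zero_rpow hs1, zero_mul]
  refine ⟨fun x => F x / ∑ x, F x, ⟨⟨fun x => div_nonneg (hF0 x) hκ.le, ?_⟩, fun x hx => ?_⟩,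
    ∑ x, F x, hκ, fun x => ?_⟩
  · rw [← Finset.sum_div, div_self hκ.ne']
  · simp only [hzero x hx, zero_div]
  · change P x ^ (1 + s) = (∑ x, F x) * (F x / (∑ x, F x) * margE P x.2 ^ s)
    rcases (hP.1 x).eq_or_lt with h0 | h0
    · rw [hzero x h0.symm, ← h0, Real.zero_rpow hs1]; ring
    · rw [← mul_assoc, mul_div_cancel₀ _ hκ.ne']
      simp only [hF]
      rw [mul_assoc, ← Real.rpow_add (h0.trans_le (le_margE hP.1 x)), neg_add_cancel,
        Real.rpow_zero, mul_one]

end Tilting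

/-! ### From extended-real Rényi entropies to real numbers. -/

section Renyi

variable {A E : Type*} [Fintype A] [Fintype E]

lemma renyiRel_eq_coe {P : A × E → ℝ} {Q : E → ℝ} {s H : ℝ} (hP : ∀ x, 0 ≤ P x)
    (hQ : ∀ e, 0 ≤ Q e) (hPQ : ∀ x, Q x.2 = 0 → P x = 0) (hs : 0 < s)
    (hG : ∑ x : A × E, P x ^ (1 + s) * Q x.2 ^ (-s) = Real.exp (-(s * H))) :
    renyiRel s P Q = H := by
  have h1 : ∀ x ∈ (Finset.univ : Finset (A × E)),
      ENNReal.ofReal (P x) ^ (1 + s) * ENNReal.ofReal (Q x.2) ^ (-s) =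
        ENNReal.ofReal (P x ^ (1 + s) * Q x.2 ^ (-s)) := by
    intro x _
    have hs1 : 0 < 1 + s := by positivity
    rcases (hQ x.2).eq_or_lt with h0 | h0
    · rw [hPQ x h0.symm, Real.zero_rpow hs1.ne', ENNReal.ofReal_zero, zero_mul,
        ENNReal.zero_rpow_of_pos hs1, ENNReal.ofReal_zero, zero_mul]
    · rw [ENNReal.ofReal_mul (Real.rpow_nonneg (hP x) _),
        ENNReal.ofReal_rpow_of_nonneg (hP x) hs1.le, ENNReal.ofReal_rpow_of_pos h0]
  rw [renyiRel, Finset.sum_congr rfl h1, ← ENNReal.ofReal_sum_of_nonneg fun x _ =>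
    mul_nonneg (Real.rpow_nonneg (hP x) _) (Real.rpow_nonneg (hQ _) _), hG,
    ENNReal.log_ofReal_of_pos (Real.exp_pos _), Real.log_exp, ← EReal.coe_mul]
  congr 1
  field_simp

/-- A zero of `Q` where `P` is positive makes the sum infinite and the entropy `⊥`; otherwise the
sum is a positive real. -/
lemma exists_of_renyiRel_ne_bot {P : A × E → ℝ} {Q : E → ℝ} {s : ℝ} (hP : IsDist P)
    (hQ : ∀ e, 0 ≤ Q e) (hs : 0 < s) (hne : renyiRel s P Q ≠ ⊥) :
    (∀ x, Q x.2 = 0 → P x = 0) ∧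
      ∃ H : ℝ, ∑ x : A × E, P x ^ (1 + s) * Q x.2 ^ (-s) = Real.exp (-(s * H)) := by
  have hPQ : ∀ x : A × E, Q x.2 = 0 → P x = 0 := by
    intro x hx
    by_contra hp
    refine hne ?_
    have hp' : 0 < P x := (hP.1 x).lt_of_ne' hp
    have htop : ∑ x : A × E, ENNReal.ofReal (P x) ^ (1 + s) * ENNReal.ofReal (Q x.2) ^ (-s) =
        ⊤ := by
      refine ENNReal.sum_eq_top.2 ⟨x, Finset.mem_univ _, ?_⟩
      rw [hx, ENNReal.ofReal_zero, ENNReal.zero_rpow_of_neg (neg_lt_zero.2 hs),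
        ENNReal.mul_top]
      exact (ENNReal.rpow_pos (ENNReal.ofReal_pos.2 hp') ENNReal.ofReal_ne_top).ne'
    rw [renyiRel, htop, ENNReal.log_top,
      EReal.coe_mul_top_of_neg (neg_lt_zero.2 (by positivity))]
  refine ⟨hPQ, -(1 / s) * Real.log (∑ x : A × E, P x ^ (1 + s) * Q x.2 ^ (-s)), ?_⟩
  obtain ⟨x, hx⟩ := hP.exists_pos
  have hq : 0 < Q x.2 := (hQ _).lt_of_ne' fun h => hx.ne' (hPQ x h)
  have hpos : 0 < ∑ x : A × E, P x ^ (1 + s) * Q x.2 ^ (-s) :=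
    Finset.sum_pos' (fun x _ => mul_nonneg (Real.rpow_nonneg (hP.1 x) _)
      (Real.rpow_nonneg (hQ _) _)) ⟨x, Finset.mem_univ _,
        mul_pos (Real.rpow_pos_of_pos hx _) (Real.rpow_pos_of_pos hq _)⟩
  have : -(s * (-(1 / s) * Real.log (∑ x : A × E, P x ^ (1 + s) * Q x.2 ^ (-s)))) =
      Real.log (∑ x : A × E, P x ^ (1 + s) * Q x.2 ^ (-s)) := by field_simp
  rw [this, Real.exp_log hpos]

lemma lt_coe_mul_sub_iff {k R : ℝ} (hk : 0 < k) {a x : EReal} :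
    a < (k : EReal) * (x - R) ↔ a / k + R < x := by
  rw [mul_comm, ← EReal.div_lt_iff (EReal.coe_pos.2 hk) (EReal.coe_ne_top k),
    EReal.lt_sub_iff_add_lt (Or.inl (EReal.coe_ne_bot R)) (Or.inl (EReal.coe_ne_top R))]

lemma expD_nonneg (P : A × E → ℝ) (R : ℝ) : 0 ≤ expD P R := by
  refine le_iSup₂_of_le 0 le_rfl ?_
  simp

lemma expI_nonneg (P : A × E → ℝ) (R : ℝ) : 0 ≤ expI P R := by
  refine le_iSup₂_of_le 0 le_rfl ?_
  simp

lemma le_expD {P : A × E → ℝ} {Q : E → ℝ} {s H : ℝ} (hP : ∀ x, 0 ≤ P x)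
    (hQ : IsDist Q) (hPQ : ∀ x, Q x.2 = 0 → P x = 0) (hs : 0 < s)
    (hG : ∑ x : A × E, P x ^ (1 + s) * Q x.2 ^ (-s) = Real.exp (-(s * H))) (R : ℝ) :
    ((s / (1 + 2 * s) * (H - R) : ℝ) : EReal) ≤ expD P R := by
  refine le_iSup₂_of_le s hs.le ?_
  rw [EReal.coe_mul, EReal.coe_sub]
  refine mul_le_mul_of_nonneg_left (EReal.sub_le_sub ?_ le_rfl)
    (EReal.coe_nonneg.2 (by positivity))
  rw [renyiUp, if_neg hs.ne', ← renyiRel_eq_coe hP hQ.1 hPQ hs hG]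
  exact le_iSup₂_of_le Q hQ le_rfl

lemma le_expI {P : A × E → ℝ} {s H : ℝ} (hP : IsDist P) (hs : 0 < s)
    (hG : ∑ x : A × E, P x ^ (1 + s) * margE P x.2 ^ (-s) = Real.exp (-(s * H))) (R : ℝ) :
    ((s / (1 + s) * (H - R) : ℝ) : EReal) ≤ expI P R := by
  refine le_iSup₂_of_le s hs.le ?_
  rw [EReal.coe_mul, EReal.coe_sub, renyiDown, if_neg hs.ne', renyiRel_eq_coe hP.1 hP.margE.1
    (fun x hx => le_antisymm ((le_margE hP.1 x).trans_eq hx) (hP.1 x)) hs hG]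

end Renyi

/-! ### Matching the two bounds on the exponents. -/

section Exponents

variable {A E : Type*} [Fintype A] [Fintype E]

lemma eventually_lt_expRate_deltaDMin {P : A × E → ℝ} (hP : IsDist P) {R ε : ℝ}
    {a : EReal} (ha : a < expD P R) :
    ∀ᶠ n : ℕ in atTop, a < expRate n (deltaDMin (Real.exp (n * R)) ε (iid P n)) := by
  simp only [expD, lt_iSup_iff] at ha
  obtain ⟨s, hs, ha⟩ := ha
  rcases hs.eq_or_lt with rfl | hs
  · have ha' : a < ((0 : ℝ) : EReal) := by simpa using ha
    refine eventually_lt_expRate (K := 2) two_pos (Eventually.of_forall fun n => ?_) ha'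
    simpa using deltaDMin_le_two (hP.iid n) _ ε
  · have hk : 0 < s / (1 + 2 * s) := by positivity
    rw [lt_coe_mul_sub_iff hk, renyiUp, if_neg hs.ne'] at ha
    simp only [lt_iSup_iff] at ha
    obtain ⟨Q, hQ, ha⟩ := ha
    obtain ⟨hPQ, H, hG⟩ := exists_of_renyiRel_ne_bot hP hQ.1 hs ha.ne_bot
    rw [renyiRel_eq_coe hP.1 hQ.1 hPQ hs hG, ← lt_coe_mul_sub_iff hk, ← EReal.coe_sub,
      ← EReal.coe_mul] at ha
    exact eventually_lt_expRate (by positivity) (Eventually.of_forall fun n =>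
      deltaDMin_iid_le hP hQ hPQ hs hG R ε n) ha

/-- Absorbs the factor linear in `n` produced by `η` into an arbitrarily small loss of exponent. -/
lemma mul_nat_add_le_mul_exp {k l δ : ℝ} (hk : 0 ≤ k) (hl : 0 ≤ l) (hδ : 0 < δ) (n : ℕ) :
    n * k + l ≤ (k / δ + l) * Real.exp (n * δ) := by
  have h0 : 0 ≤ n * δ := by positivity
  have h1 : n * δ ≤ Real.exp (n * δ) := by linarith [Real.add_one_le_exp (n * δ)]
  have h2 : 1 ≤ Real.exp (n * δ) := Real.one_le_exp h0
  have h3 : n * k = k / δ * (n * δ) := by field_simp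
  have h4 := mul_le_mul_of_nonneg_left h1 (div_nonneg hk hδ.le)
  nlinarith

lemma eventually_lt_expRate_deltaIMin {P : A × E → ℝ} (hP : IsDist P) {R ε : ℝ} (hε : 0 < ε)
    (hR : 0 < R) {a : EReal} (ha : a < expI P R) :
    ∀ᶠ n : ℕ in atTop, a < expRate n (deltaIMin (Real.exp (n * R)) ε (iid P n)) := by
  -- For negative `a` the choice `P' = 0` suffices: its bound `n R` is subexponential. For `a ≥ 0`
  -- the selected term is positive, which yields the `R ≤ H` needed by `deltaIMin_iid_le`.
  by_cases ha0 : a < 0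
  · obtain ⟨b, hab, hb⟩ := EReal.lt_iff_exists_real_btwn.1 ha0
    have hb' : b < 0 := by exact_mod_cast hb
    refine eventually_lt_expRate (K := R / -b + 0)
      (by have := neg_pos.2 hb'; positivity) (Eventually.of_forall fun n => ?_) hab
    refine (deltaIMin_le_log (hP.iid n) (Real.exp_pos _).le hε.le).trans
      (EReal.coe_le_coe_iff.2 ?_)
    rw [Real.log_exp, ← mul_neg]
    simpa using mul_nat_add_le_mul_exp hR.le le_rfl (neg_pos.2 hb') n
  simp only [expI, lt_iSup_iff] at ha
  obtain ⟨s, hs, ha⟩ := ha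
  rcases hs.eq_or_lt with rfl | hs
  · exact absurd (by simpa using ha) ha0
  · have hk : 0 < s / (1 + s) := by positivity
    rw [renyiDown, if_neg hs.ne'] at ha
    obtain ⟨hPQ, H, hG⟩ := exists_of_renyiRel_ne_bot hP hP.margE.1 hs
      ((lt_coe_mul_sub_iff hk).1 ha).ne_bot
    rw [renyiRel_eq_coe hP.1 hP.margE.1 hPQ hs hG, ← EReal.coe_sub, ← EReal.coe_mul] at ha
    have hpos : 0 < s / (1 + s) * (H - R) := by
      exact_mod_cast (not_lt.1 ha0).trans_lt ha
    have hH : R ≤ H := by linarith [(mul_pos_iff_of_pos_left hk).1 hpos]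
    obtain ⟨b, hab, hb⟩ := EReal.lt_iff_exists_real_btwn.1 ha
    have hb' : 0 < s / (1 + s) * (H - R) - b := sub_pos.2 (by exact_mod_cast hb)
    refine eventually_lt_expRate
      (K := (R + s / (1 + s) * (H - R)) / (s / (1 + s) * (H - R) - b) + (1 + ε))
      (by positivity) (Eventually.of_forall fun n => ?_) hab
    refine (deltaIMin_iid_le hP hs hG hε.le hR.le hH n).trans (EReal.coe_le_coe_iff.2 ?_)
    refine (mul_le_mul_of_nonneg_left (mul_nat_add_le_mul_exp (by positivity) (by positivity)
      hb' n) (Real.exp_pos _).le).trans_eq ?_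
    rw [mul_left_comm, ← Real.exp_add]
    congr 2
    ring

/-- Otherwise some convex combination is at least `c` for all `W`, yet at the tilted `W` it equals a
term of `expD P R`, which is below `c`. -/
lemma exists_max_lt_of_expD_lt {P : A × E → ℝ} (hP : IsDist P) {R c c' : ℝ}
    (hc : expD P R < c) (hcc : c < c') :
    ∃ W ∈ absContDists P, max (∑ x, W x * (Real.log (W x) - Real.log (P x)))
      ((∑ x : A × E, W x * (Real.log (margE W x.2) - Real.log (P x)) - R) / 2) < c' := by
  by_contra! hcon
  have hPm : P ∈ absContDists P := ⟨hP, fun _ h => h⟩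
  have hc0 : 0 < c := by exact_mod_cast (expD_nonneg P R).trans_lt hc
  have hg : ConvexOn ℝ (absContDists P) fun W =>
      (∑ x : A × E, W x * (Real.log (margE W x.2) - Real.log (P x)) - R) / 2 := by
    have := ((convexOn_sum_mul_log_margE_sub P).add_const (-R)).smul
      (show (0 : ℝ) ≤ 1 / 2 by norm_num)
    refine this.congr fun W _ => ?_
    simp only [Pi.add_apply, smul_eq_mul]
    ring
  obtain ⟨l, hl0, hl1, hl⟩ := exists_weight_lt_one_forall_le ⟨P, hPm⟩
    (convexOn_sum_mul_log_sub P) hg (fun W hW => divergence_nonneg hP hW) hc0 hcc hcon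
  -- Weight `0` is impossible: at `W = P` the divergence is `0`, below `c`.
  rcases hl0.eq_or_lt with rfl | hl0
  · have := hl P hPm
    simp only [sub_self, mul_zero, Finset.sum_const_zero, zero_mul, add_zero] at this
    linarith
  -- With this `s`, `1 - l = 1 / (1 + 2 * s)` and the combination is `1 - l` times the divergence
  -- plus `s` times the unhalved second cost.
  set s := l / (2 * (1 - l)) with hs
  have h1l : 0 < 1 - l := sub_pos.2 hl1
  have hs0 : 0 < s := by positivity
  obtain ⟨W, hW, κ, hκ, hqP, htilt⟩ := exists_tilted_up hP hs0
  have h1 := hl W hW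
  have h2 := divergence_add_of_tilted hκ hP.1 (fun x => hW.1.margE.1 x.2) hqP hW.1 hW.2 htilt
  have h3 := sum_rpow_of_tilted hs0 (fun x => hW.1.margE.1 x.2) hqP hW.1 hW.2 htilt
  have h4 := le_expD (H := -Real.log κ / s) hP.1 hW.1.margE hqP hs0
    (by rw [h3, mul_div_cancel₀ _ hs0.ne', neg_neg, Real.exp_log hκ]) R
  have h5 : s / (1 + 2 * s) * (-Real.log κ / s - R) < c := by exact_mod_cast h4.trans_lt hc
  refine h5.not_ge (h1.trans_eq ?_)
  rw [← h2]
  have hl' : l = 2 * s / (1 + 2 * s) := by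
    rw [hs]; field_simp; ring
  rw [hl']
  field_simp
  ring

lemma exists_max_lt_of_expI_lt {P : A × E → ℝ} (hP : IsDist P) {R c c' : ℝ}
    (hc : expI P R < c) (hcc : c < c') :
    ∃ W ∈ absContDists P, max (∑ x, W x * (Real.log (W x) - Real.log (P x)))
      (∑ x : A × E, W x * (Real.log (margE P x.2) - Real.log (P x)) - R) < c' := by
  by_contra! hcon
  have hPm : P ∈ absContDists P := ⟨hP, fun _ h => h⟩
  have hc0 : 0 < c := by exact_mod_cast (expI_nonneg P R).trans_lt hc
  have hg : ConvexOn ℝ (absContDists P) fun W =>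
      ∑ x : A × E, W x * (Real.log (margE P x.2) - Real.log (P x)) - R :=
    (convexOn_sum_mul fun x => Real.log (margE P x.2) - Real.log (P x)).add_const (-R)
  obtain ⟨l, hl0, hl1, hl⟩ := exists_weight_lt_one_forall_le ⟨P, hPm⟩
    (convexOn_sum_mul_log_sub P) hg (fun W hW => divergence_nonneg hP hW) hc0 hcc hcon
  rcases hl0.eq_or_lt with rfl | hl0
  · have := hl P hPm
    simp only [sub_self, mul_zero, Finset.sum_const_zero, zero_mul, add_zero] at this
    linarith
  set s := l / (1 - l) with hs
  have h1l : 0 < 1 - l := sub_pos.2 hl1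
  have hs0 : 0 < s := by positivity
  have hqP : ∀ x : A × E, margE P x.2 = 0 → P x = 0 := fun x hx =>
    le_antisymm ((le_margE hP.1 x).trans_eq hx) (hP.1 x)
  obtain ⟨W, hW, κ, hκ, htilt⟩ := exists_tilted_down hP hs0
  have h1 := hl W hW
  have h2 := divergence_add_of_tilted hκ hP.1 (fun x => hP.margE.1 x.2) hqP hW.1 hW.2 htilt
  have h3 := sum_rpow_of_tilted hs0 (fun x => hP.margE.1 x.2) hqP hW.1 hW.2 htilt
  have h4 := le_expI (H := -Real.log κ / s) hP hs0
    (by rw [h3, mul_div_cancel₀ _ hs0.ne', neg_neg, Real.exp_log hκ]) R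
  have h5 : s / (1 + s) * (-Real.log κ / s - R) < c := by exact_mod_cast h4.trans_lt hc
  refine h5.not_ge (h1.trans_eq ?_)
  rw [← h2]
  have hl' : l = s / (1 + s) := by
    rw [hs]; field_simp; ring
  rw [hl']
  field_simp
  ring

lemma eventually_expRate_deltaDMin_lt {P : A × E → ℝ} (hP : IsDist P) {R ε : ℝ} (hε : 0 < ε)
    {a : EReal} (ha : expD P R < a) :
    ∀ᶠ n : ℕ in atTop, expRate n (deltaDMin (Real.exp (n * R)) ε (iid P n)) < a := by
  obtain ⟨c', hc', hca⟩ := EReal.lt_iff_exists_real_btwn.1 ha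
  obtain ⟨c, hc, hcc⟩ := EReal.lt_iff_exists_real_btwn.1 hc'
  obtain ⟨W, hW, hmax⟩ := exists_max_lt_of_expD_lt hP hc (EReal.coe_lt_coe_iff.1 hcc)
  obtain ⟨h1, h2⟩ := max_lt_iff.1 hmax
  set f := ∑ x, W x * (Real.log (W x) - Real.log (P x)) with hf
  set h := ∑ x : A × E, W x * (Real.log (margE W x.2) - Real.log (W x)) with hh
  have hsum : ∑ x : A × E, W x * (Real.log (margE W x.2) - Real.log (P x)) = f + h := by
    rw [hf, hh, ← Finset.sum_add_distrib]
    exact Finset.sum_congr rfl fun x _ => by ring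
  rw [hsum] at h2
  -- Both `μ` and `ν` are raised by `δ`, and the halving turns the total `2 * δ` back into `δ`.
  set δ := min (c' - f) (c' - (f + h - R) / 2) with hδ
  have hδ0 : 0 < δ := lt_min (by linarith) (by linarith)
  have hδ1 : δ ≤ c' - f := min_le_left _ _
  have hδ2 : δ ≤ c' - (f + h - R) / 2 := min_le_right _ _
  exact eventually_expRate_lt (lt_min (by norm_num) (by positivity))
    (eventually_le_deltaDMin (μ := f + δ) (ν := h + δ) hP hW.1 hW.2 hε
      (by linarith) (by linarith) (by linarith) (by linarith)) hca

lemma eventually_expRate_deltaIMin_lt {P : A × E → ℝ} (hP : IsDist P) {R ε : ℝ} (hε : 0 < ε)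
    (hR : 0 < R) {a : EReal} (ha : expI P R < a) :
    ∀ᶠ n : ℕ in atTop, expRate n (deltaIMin (Real.exp (n * R)) ε (iid P n)) < a := by
  obtain ⟨c', hc', hca⟩ := EReal.lt_iff_exists_real_btwn.1 ha
  obtain ⟨c, hc, hcc⟩ := EReal.lt_iff_exists_real_btwn.1 hc'
  obtain ⟨W, hW, hmax⟩ := exists_max_lt_of_expI_lt hP hc (EReal.coe_lt_coe_iff.1 hcc)
  obtain ⟨h1, h2⟩ := max_lt_iff.1 hmax
  exact eventually_expRate_lt (lt_min (by norm_num) (by positivity))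
    (eventually_le_deltaIMin (κ := c' + R) hP hW.1 hW.2 hε hR h1 (by linarith) le_rfl
      (by linarith)) hca

end Exponents
end MinEntropySmoothing

theorem mainTheorem9 {A E : Type*} [Fintype A] [Fintype E]
    (P : A × E → ℝ) (hP : MinEntropySmoothing.IsDist P)
    (R : ℝ) (ε : ℝ) (hε : 0 < ε) :
    Tendsto
        (fun n : ℕ => MinEntropySmoothing.expRate n
          (MinEntropySmoothing.deltaDMin (Real.exp (n * R)) ε (MinEntropySmoothing.iid P n)))
        atTop (𝓝 (MinEntropySmoothing.expD P R)) ∧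
      (0 < R →
        Tendsto
          (fun n : ℕ => MinEntropySmoothing.expRate n
            (MinEntropySmoothing.deltaIMin (Real.exp (n * R)) ε (MinEntropySmoothing.iid P n)))
          atTop (𝓝 (MinEntropySmoothing.expI P R))) := by
  open MinEntropySmoothing in
  exact ⟨tendsto_order.2 ⟨fun _ ha => eventually_lt_expRate_deltaDMin hP ha,
      fun _ ha => eventually_expRate_deltaDMin_lt hP hε ha⟩,
    fun hR => tendsto_order.2 ⟨fun _ ha => eventually_lt_expRate_deltaIMin hP hε hR ha,
      fun _ ha => eventually_expRate_deltaIMin_lt hP hε hR ha⟩⟩
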